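/- **Lemma 2.1.** Let $1/2<H<1$ and $1/2<h<1$, and put $\theta(a):=2\Gamma(2-2a)\cos(\pi(1-a))$ (with $\Gamma$ the gamma function) and $D(a):=\theta(a)/(a(2a-1))$ for $1/2<a<1$. For real sequences, $a_n\sim b_n$ means $a_n/b_n\to1$. Suppose that: * $\varepsilon_t$, $t\in\mathbb Z$, are i.i.d. with mean $0$ and variance $1$, and $u_t:=\sum_{j=0}^\infty b_j\varepsilon_{t-j}$ (convergence in mean square), where $\sum_{j\ge0}b_j^2=1$ and $b_j\sim C\,j^{-(3/2-H)}$ as $j\to\infty$ for some constant $C\ne0$; * $X_t$, $t\in\mathbb Z$, is a strictly stationary Gaussian process, independent of the process $(\varepsilon_t)$, whose auto-covariance function $\gamma_X$ satisfies $\gamma_X(k)\sim G_X\,\theta(h)\,k^{-2(1-h)}$ as $k\to\infty$ for some constant $G_X>0$; * $\sigma:\mathbb R\to\mathbb R$ is measurable with $E\sigma^2(X_0)<\infty$, and $Y_t=\beta_0+\beta_1X_t+\sigma(X_t)u_t$, $t\in\mathbb Z$, for some $(\beta_0,\beta_1)\in\mathbb R^2$. Let $\mu:=EX_0$, $\gamma^2:=\mathrm{Var}(X_0)$,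 $\sigma_0:=E\sigma(X_0)$, $J:=E[X_0\sigma(X_0)]$, $$\Gamma_1:=\frac{J-\mu\sigma_0}{\gamma^2},\qquad \Gamma_0:=\sigma_0-\frac{(J-\mu\sigma_0)\mu}{\gamma^2},$$ and let $(\hat\beta_0,\hat\beta_1)$ be the least squares estimator of $(\beta_0,\beta_1)$ based on $(X_t,Y_t)$, $1\le t\le n$, that is, a (measurable) minimizer of $\sum_{t=1}^n(Y_t-c_0-c_1X_t)^2$ over $(c_0,c_1)\in\mathbb R^2$. Then there is a constant $G_u>0$ such that the auto-covariance function of $(u_t)$ satisfies $\gamma_u(k)\sim G_u\,\theta(H)\,k^{-2(1-H)}$ as $k\to\infty$, and, with $Z_1$ a normal random variable with mean $0$ and variance $\psi_1^2:=G_uD(H)$, as $n\to\infty$, $$n^{-H}\sum_{t=1}^nu_t\to_d Z_1,\qquad n^{1-H}\bigl(\hat\beta_0-\beta_0,\ \hat\beta_1-\beta_1\bigr)\to_d(\Gamma_0,\Gamma_1)\,Z_1 .$$ Moreover, if $\sigma$ is constant, or if $\mu=0$ and $\sigma$ is even, then $\Gamma_1=0$ and $n^{1-H}(\hat\beta_1-\beta_1)\to_d0$.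 -/

import Mathlib

open MeasureTheory ProbabilityTheory Filter Asymptotics
open scoped Topology

namespace LongMemoryRegression

noncomputable section

/-- The constant `θ(a) = 2 Γ(2 - 2a) cos(π (1 - a))`. -/
def theta (a : ℝ) : ℝ := 2 * Real.Gamma (2 - 2 * a) * Real.cos (Real.pi * (1 - a))

/-- The constant `D(a) = θ(a) / (a (2a - 1))`. -/
def dConst (a : ℝ) : ℝ := theta a / (a * (2 * a - 1))

section Processes

variable {Ω : Type*} [MeasurableSpace Ω]

/-- `ε` is a two-sided sequence of i.i.d. random variables with mean zero and variance one. -/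
structure IsStandardizedIID (ε : ℤ → Ω → ℝ) (P : Measure Ω) : Prop where
  measurable : ∀ t, Measurable (ε t)
  indep : iIndepFun ε P
  identDistrib : ∀ t, IdentDistrib (ε t) (ε 0) P P
  memLp : MemLp (ε 0) 2 P
  mean_zero : P[ε 0] = 0
  variance_one : Var[ε 0; P] = 1

/-- `u t = ∑_{j ≥ 0} b j * ε (t - j)` for all `t`, the series converging in mean square. (The
coefficients of interest are not absolutely summable, so an unconditional sum `∑'` for each sample
point would not do.) -/
structure IsMovingAverage (b : ℕ → ℝ) (ε u : ℤ → Ω → ℝ) (P : Measure Ω) : Prop where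
  aestronglyMeasurable : ∀ t, AEStronglyMeasurable (u t) P
  tendsto : ∀ t : ℤ, Tendsto
    (fun N : ℕ => eLpNorm (fun ω => u t ω - ∑ j ∈ Finset.range N, b j * ε (t - j) ω) 2 P)
    atTop (𝓝 0)

/-- Strict stationarity: every time shift of the process has the same law, as a random element of
`ℤ → ℝ`, as the process itself. -/
def IsStrictlyStationary (X : ℤ → Ω → ℝ) (P : Measure Ω) : Prop :=
  ∀ k : ℤ, IdentDistrib (fun ω t => X (t + k) ω) (fun ω t => X t ω) P P

/-- The auto-covariance function `k ↦ Cov(X_0, X_k)` of a stationary process, at lags `k ≥ 0`. -/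
def autoCov (X : ℤ → Ω → ℝ) (P : Measure Ω) (k : ℕ) : ℝ := cov[X 0, X k; P]

/-- `Γ₁ = (E[X σ(X)] - E[X] E[σ(X)]) / Var X`, for a random variable `X`. -/
def Gamma1 (X : Ω → ℝ) (σ : ℝ → ℝ) (P : Measure Ω) : ℝ :=
  ((∫ ω, X ω * σ (X ω) ∂P) - (∫ ω, X ω ∂P) * ∫ ω, σ (X ω) ∂P) / Var[X; P]

/-- `Γ₀ = E[σ(X)] - (E[X σ(X)] - E[X] E[σ(X)]) E[X] / Var X`, for a random variable `X`. -/
def Gamma0 (X : Ω → ℝ) (σ : ℝ → ℝ) (P : Measure Ω) : ℝ :=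
  (∫ ω, σ (X ω) ∂P) -
    ((∫ ω, X ω * σ (X ω) ∂P) - (∫ ω, X ω ∂P) * ∫ ω, σ (X ω) ∂P) * (∫ ω, X ω ∂P) / Var[X; P]

end Processes

/-- The residual sum of squares `∑_{t=1}^n (y_t - c₀ - c₁ x_t)²`. -/
def residualSumSq (x y : ℤ → ℝ) (n : ℕ) (c₀ c₁ : ℝ) : ℝ :=
  ∑ t ∈ Finset.Icc (1 : ℤ) n, (y t - c₀ - c₁ * x t) ^ 2

/-- `(b₀, b₁)` is a least squares estimate of (intercept, slope) from the observations
`(x_t, y_t)`, `1 ≤ t ≤ n`. -/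
def IsLeastSquaresEstimate (x y : ℤ → ℝ) (n : ℕ) (b₀ b₁ : ℝ) : Prop :=
  ∀ c₀ c₁ : ℝ, residualSumSq x y n b₀ b₁ ≤ residualSumSq x y n c₀ c₁

end

end LongMemoryRegression

/-!
The proof separates the randomness of the design `X` from that of the errors `u`.

*Errors.* The auto-covariance of `u` at lag `k` is `∑ j, b j * b (j + k)`, a Riemann sum for
`C² k^{-2(1-H)} ∫₀^∞ x^{-p} (1+x)^{-p} dx`, `p = 3/2 - H`, and the variance of `∑_{t ≤ n} u t` is a
Riemann sum for `∫₀¹ (1-x) x^{-2(1-H)} dx`; both limits come from dominated convergence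
(`tendsto_tsum_of_riemann`). The normalized partial sum `n^{-H} ∑ u t` is a linear combination of
the innovations whose weights are at most `n^{1/2-H}` by the Cauchy–Schwarz inequality, so a
central limit theorem for weighted sums (`tendstoInDistribution_weighted_sum`) applies after
truncating the moving average far enough in the past.

*Design.* A standard Gaussian pair with correlation `ρ` has, with respect to the product law, a
density that tends to `1` as `ρ → 0` and is at most `2 exp(x²/8) exp(y²/8)` for `|ρ| ≤ 1/3`. Hence
`E[f(ξ₀) f(ξ_k)] → (E f(ξ₀))²` for every `f` with `|f(x)| ≤ (1+|x|) g(x)`, `g` square integrable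
(`tendsto_integral_mehlerKernel_mul`). This class contains `x σ(x)`, which need not be square
integrable. By independence of `X` and `u`, the second moment of `n^{-H} ∑ f(X_t) u_t` for centred
`f` is a double sum of products of covariances, and it vanishes in the limit once `f` is truncated
at a small power of `n` (`IsMixingStdGaussian.tendstoInMeasure_sum_mul`). So `∑ σ(X_t) u_t` and
`∑ X_t σ(X_t) u_t` behave like `E[σ(X₀)] ∑ u_t` and `E[X₀ σ(X₀)] ∑ u_t`. The same estimate with
`u = 1` is the law of large numbers for the Gram matrix.

*Regression.* The normal equations express the rescaled estimation errors as a continuous function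
of these quantities off an event of vanishing probability, and Slutsky's theorem gives the limit
(`tendstoInDistribution_of_normal_equations`).
-/

namespace LongMemoryRegression

/-! ### Riemann sums and power asymptotics -/

theorem hasSum_integral_floor {k : ℕ} (hk : 0 < k) (F : ℕ → ℝ)
    (hF : IntegrableOn (fun x : ℝ => (k : ℝ) * F ⌊(k : ℝ) * x⌋₊) (Set.Ioi 0)) :
    HasSum F (∫ x in Set.Ioi (0 : ℝ), (k : ℝ) * F ⌊(k : ℝ) * x⌋₊) := by
  have hk' : (0 : ℝ) < k := by exact_mod_cast hk
  let s : ℕ → Set ℝ := fun j => Set.Ico ((j : ℝ) / k) (((j : ℝ) + 1) / k)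
  have hmem : ∀ j x, x ∈ s j ↔ 0 ≤ x ∧ ⌊(k : ℝ) * x⌋₊ = j := by
    intro j x
    simp only [s, Set.mem_Ico, div_le_iff₀ hk', lt_div_iff₀ hk']
    constructor
    · rintro ⟨h1, h2⟩
      have h0 : 0 ≤ x * k := (Nat.cast_nonneg j).trans h1
      have hx : 0 ≤ x := nonneg_of_mul_nonneg_left h0 hk'
      refine ⟨hx, (Nat.floor_eq_iff (by positivity)).2 ⟨by linarith, by linarith⟩⟩
    · rintro ⟨hx, h⟩
      obtain ⟨h1, h2⟩ := (Nat.floor_eq_iff (by positivity)).1 h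
      constructor <;> linarith
  have hU : (⋃ j, s j) = Set.Ici 0 := by
    ext x
    simp only [Set.mem_iUnion, hmem, Set.mem_Ici]
    exact ⟨fun ⟨_, h, _⟩ => h, fun h => ⟨_, h, rfl⟩⟩
  have hdisj : Pairwise (Function.onFun Disjoint s) := by
    intro i j hij
    refine Set.disjoint_left.2 fun x hi hj => hij ?_
    rw [← ((hmem i x).1 hi).2, ((hmem j x).1 hj).2]
  have hF' : IntegrableOn (fun x : ℝ => (k : ℝ) * F ⌊(k : ℝ) * x⌋₊) (⋃ j, s j) := by
    rw [hU, integrableOn_Ici_iff_integrableOn_Ioi]; exact hF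
  have h := hasSum_integral_iUnion (fun j => measurableSet_Ico) hdisj hF'
  rw [hU, integral_Ici_eq_integral_Ioi] at h
  refine h.congr_fun fun j => ?_
  rw [setIntegral_congr_fun (g := fun _ => (k : ℝ) * F j) measurableSet_Ico
    (fun x hx => by simp only [((hmem j x).1 hx).2])]
  have : ((j : ℝ) + 1) / k - j / k = 1 / k := by ring
  simp only [setIntegral_const, smul_eq_mul, measureReal_def, Real.volume_Ico, this]
  rw [ENNReal.toReal_ofReal (by positivity)]
  field_simp

/-- Dominated convergence for Riemann sums over the grid of mesh `1 / k`: the rescaled step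
functions `x ↦ k * F k ⌊k x⌋` integrate to `∑ j, F k j`. -/
theorem tendsto_tsum_of_riemann {F : ℕ → ℕ → ℝ} {g G : ℝ → ℝ}
    (hG : IntegrableOn G (Set.Ioi 0))
    (hF : ∀ᶠ k : ℕ in atTop, ∀ x : ℝ, 0 < x → |(k : ℝ) * F k ⌊(k : ℝ) * x⌋₊| ≤ G x)
    (hlim : ∀ᵐ x ∂volume.restrict (Set.Ioi (0 : ℝ)),
      Tendsto (fun k : ℕ => (k : ℝ) * F k ⌊(k : ℝ) * x⌋₊) atTop (𝓝 (g x))) :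
    Tendsto (fun k => ∑' j, F k j) atTop (𝓝 (∫ x in Set.Ioi (0 : ℝ), g x)) := by
  have hmeas : ∀ k : ℕ, Measurable (fun x : ℝ => (k : ℝ) * F k ⌊(k : ℝ) * x⌋₊) := fun k =>
    ((measurable_from_nat (f := F k)).comp
      (Nat.measurable_floor.comp (measurable_const_mul (k : ℝ)))).const_mul _
  have hmain := tendsto_integral_filter_of_dominated_convergence
    (μ := volume.restrict (Set.Ioi (0 : ℝ))) (l := atTop) G
    (F := fun (k : ℕ) (x : ℝ) => (k : ℝ) * F k ⌊(k : ℝ) * x⌋₊) (f := g)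
    (Eventually.of_forall fun k => (hmeas k).aestronglyMeasurable)
    (hF.mono fun k hk => (ae_restrict_iff' measurableSet_Ioi).2
      (Eventually.of_forall fun x hx => hk x hx)) hG hlim
  refine hmain.congr' ?_
  filter_upwards [hF, eventually_gt_atTop 0] with k hk hk0
  have hint : IntegrableOn (fun x : ℝ => (k : ℝ) * F k ⌊(k : ℝ) * x⌋₊) (Set.Ioi 0) :=
    Integrable.mono' hG (hmeas k).aestronglyMeasurable
      ((ae_restrict_iff' measurableSet_Ioi).2 (Eventually.of_forall fun x hx => hk x hx))
  exact (hasSum_integral_floor hk0 (F k) hint).tsum_eq.symm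

/-- If `f j ∼ c j^{-p}`, then `f` along indices `m k ∼ y k` is asymptotic to `c y^{-p} k^{-p}`. -/
theorem tendsto_mul_rpow_of_ratio {f : ℕ → ℝ} {p c y : ℝ} (hy : 0 < y)
    (hf : Tendsto (fun j : ℕ => f j * (j : ℝ) ^ p) atTop (𝓝 c)) {m : ℕ → ℕ}
    (hm : Tendsto (fun k : ℕ => (m k : ℝ) / k) atTop (𝓝 y)) :
    Tendsto (fun k : ℕ => (k : ℝ) ^ p * f (m k)) atTop (𝓝 (c * y ^ (-p))) := by
  have hmt : Tendsto m atTop atTop := by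
    rw [← tendsto_natCast_atTop_iff (R := ℝ)]
    have := hm.pos_mul_atTop hy (tendsto_natCast_atTop_atTop (R := ℝ))
    refine this.congr' ?_
    filter_upwards [eventually_gt_atTop 0] with k hk
    have : (k : ℝ) ≠ 0 := by positivity
    field_simp
  have h1 := (hf.comp hmt).mul (hm.rpow_const (p := -p) (Or.inl hy.ne'))
  refine h1.congr' ?_
  filter_upwards [eventually_gt_atTop 0, hmt.eventually (eventually_gt_atTop 0)] with k hk hmk
  have hk' : (0 : ℝ) < k := by exact_mod_cast hk
  have hmk' : (0 : ℝ) < m k := by exact_mod_cast hmk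
  simp only [Function.comp]
  rw [Real.rpow_neg (by positivity), Real.div_rpow hmk'.le hk'.le]
  have := (Real.rpow_pos_of_pos hmk' p).ne'
  field_simp

theorem exists_bound_of_tendsto_mul_rpow {f : ℕ → ℝ} {p c : ℝ}
    (hf : Tendsto (fun j : ℕ => f j * (j : ℝ) ^ p) atTop (𝓝 c)) :
    ∃ M, 0 ≤ M ∧ ∀ j : ℕ, |f j| ≤ M * ((j : ℝ) + 1) ^ (-p) := by
  have h1 : Tendsto (fun j : ℕ => f j * ((j : ℝ) + 1) ^ p) atTop (𝓝 c) := by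
    have hr : Tendsto (fun j : ℕ => (((j : ℝ) + 1) / j) ^ p) atTop (𝓝 1) := by
      have h0 : Tendsto (fun j : ℕ => ((j : ℝ) + 1) / j) atTop (𝓝 1) := by
        have := (tendsto_inv_atTop_nhds_zero_nat (𝕜 := ℝ)).const_add 1
        rw [add_zero] at this
        refine this.congr' ?_
        filter_upwards [eventually_gt_atTop 0] with j hj
        have : (j : ℝ) ≠ 0 := by positivity
        field_simp
      simpa using h0.rpow_const (p := p) (Or.inl one_ne_zero)
    have := hf.mul hr
    rw [mul_one] at this
    refine this.congr' ?_
    filter_upwards [eventually_gt_atTop 0] with j hj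
    have hj' : (0 : ℝ) < j := by exact_mod_cast hj
    rw [Real.div_rpow (by positivity) hj'.le]
    have := (Real.rpow_pos_of_pos hj' p).ne'
    field_simp
  obtain ⟨M, hM⟩ := h1.abs.bddAbove_range
  refine ⟨M, (abs_nonneg _).trans (hM ⟨0, rfl⟩), fun j => ?_⟩
  have := hM ⟨j, rfl⟩
  have hpos : (0 : ℝ) < ((j : ℝ) + 1) ^ p := by positivity
  simp only [abs_mul, abs_of_pos hpos] at this
  rw [Real.rpow_neg (by positivity), ← div_eq_mul_inv, le_div_iff₀ hpos]
  exact this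

/-- The domination used for Riemann sums, with `m = ⌊k y⌋` in mind. -/
theorem rpow_mul_abs_le_of_bound {f : ℕ → ℝ} {p M y : ℝ} (hp : 0 ≤ p) (hM : 0 ≤ M)
    (hf : ∀ j : ℕ, |f j| ≤ M * ((j : ℝ) + 1) ^ (-p)) (hy : 0 < y) {k m : ℕ}
    (hkm : (k : ℝ) * y ≤ m + 1) : (k : ℝ) ^ p * |f m| ≤ M * y ^ (-p) := by
  rcases Nat.eq_zero_or_pos k with rfl | hk
  · rcases hp.eq_or_lt with rfl | hp
    · simpa using hf m
    · rw [Nat.cast_zero, Real.zero_rpow hp.ne', zero_mul]; positivity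
  have hk' : (0 : ℝ) < k := by exact_mod_cast hk
  calc (k : ℝ) ^ p * |f m| ≤ (k : ℝ) ^ p * (M * ((k : ℝ) * y) ^ (-p)) := by
        gcongr
        refine (hf m).trans ?_
        gcongr ?_ * ?_
        exact Real.rpow_le_rpow_of_nonpos (by positivity) hkm (by linarith)
    _ = M * y ^ (-p) := by
        rw [Real.mul_rpow hk'.le hy.le, Real.rpow_neg hk'.le]
        have := (Real.rpow_pos_of_pos hk' p).ne'
        field_simp

theorem tendsto_floor_div {x : ℝ} (hx : 0 ≤ x) :
    Tendsto (fun k : ℕ => (⌊(k : ℝ) * x⌋₊ : ℝ) / k) atTop (𝓝 x) := by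
  have := (tendsto_nat_floor_mul_div_atTop hx).comp (tendsto_natCast_atTop_atTop (R := ℝ))
  refine this.congr fun k => ?_
  simp [mul_comm]

theorem integrableOn_rpow_mul_one_add_rpow {p : ℝ} (hp : 1 / 2 < p) (hp' : p < 1) :
    IntegrableOn (fun x : ℝ => x ^ (-p) * (1 + x) ^ (-p)) (Set.Ioi 0) := by
  have hm : Measurable (fun x : ℝ => x ^ (-p) * (1 + x) ^ (-p)) := by fun_prop
  rw [← Set.Ioc_union_Ioi_eq_Ioi (zero_le_one (α := ℝ))]
  refine IntegrableOn.union ?_ ?_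
  · have h : IntegrableOn (fun x : ℝ => x ^ (-p)) (Set.Ioc 0 1) := by
      rw [← intervalIntegrable_iff_integrableOn_Ioc_of_le zero_le_one]
      exact intervalIntegral.intervalIntegrable_rpow' (by linarith)
    refine Integrable.mono' h hm.aestronglyMeasurable
      ((ae_restrict_iff' measurableSet_Ioc).2 (Eventually.of_forall fun x hx => ?_))
    have hx0 : 0 < x := hx.1
    rw [Real.norm_of_nonneg (by positivity)]
    exact mul_le_of_le_one_right (by positivity)
      (Real.rpow_le_one_of_one_le_of_nonpos (by linarith) (by linarith))
  · have h := integrableOn_Ioi_rpow_of_lt (a := -p + -p) (by linarith) (zero_lt_one)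
    refine Integrable.mono' h hm.aestronglyMeasurable
      ((ae_restrict_iff' measurableSet_Ioi).2 (Eventually.of_forall fun x hx => ?_))
    have hx0 : (0 : ℝ) < x := zero_lt_one.trans hx
    rw [Real.norm_of_nonneg (by positivity), Real.rpow_add hx0]
    exact mul_le_mul_of_nonneg_left
      (Real.rpow_le_rpow_of_nonpos hx0 (by linarith) (by linarith)) (by positivity)

/-- Regularly varying coefficients `b j ∼ C j^{-p}` with `1/2 < p < 1` have autocorrelations
`∑ b j b (j+k) ∼ K k^{1-2p}` with `K > 0`. -/
theorem exists_tendsto_autocorrelation {b : ℕ → ℝ} {p C : ℝ} (hp : 1 / 2 < p) (hp' : p < 1)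
    (hC : C ≠ 0) (hb : Tendsto (fun j : ℕ => b j * (j : ℝ) ^ p) atTop (𝓝 C)) :
    ∃ K : ℝ, 0 < K ∧ Tendsto (fun k : ℕ => (k : ℝ) ^ (2 * p - 1) * ∑' j, b j * b (j + k)) atTop
      (𝓝 K) := by
  obtain ⟨M, hM, hbd⟩ := exists_bound_of_tendsto_mul_rpow hb
  have hint := integrableOn_rpow_mul_one_add_rpow hp hp'
  refine ⟨∫ x in Set.Ioi (0 : ℝ), C ^ 2 * (x ^ (-p) * (1 + x) ^ (-p)), ?_, ?_⟩
  · rw [integral_const_mul]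
    refine mul_pos (by positivity) ?_
    rw [setIntegral_pos_iff_support_of_nonneg_ae _ hint]
    · rw [Set.inter_eq_right.2]
      · simp
      · intro x hx
        have : (0 : ℝ) < x := hx
        simp only [Function.mem_support]
        positivity
    · refine (ae_restrict_iff' measurableSet_Ioi).2 (Eventually.of_forall fun x hx => ?_)
      have : (0 : ℝ) < x := hx
      simp only [Pi.zero_apply]
      positivity
  · have key : ∀ k : ℕ, 0 < k → ∀ m : ℕ, (k : ℝ) * ((k : ℝ) ^ (2 * p - 1) * (b m * b (m + k)))
        = ((k : ℝ) ^ p * b m) * ((k : ℝ) ^ p * b (m + k)) := by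
      intro k hk m
      have hk' : (0 : ℝ) < k := by exact_mod_cast hk
      have : (k : ℝ) * (k : ℝ) ^ (2 * p - 1) = (k : ℝ) ^ p * (k : ℝ) ^ p := by
        rw [← Real.rpow_add hk']
        nth_rewrite 1 [← Real.rpow_one (k : ℝ)]
        rw [← Real.rpow_add hk']; ring_nf
      rw [← mul_assoc, this]; ring
    have h := tendsto_tsum_of_riemann
      (F := fun k j => (k : ℝ) ^ (2 * p - 1) * (b j * b (j + k)))
      (g := fun x => C ^ 2 * (x ^ (-p) * (1 + x) ^ (-p)))
      (G := fun x => M ^ 2 * (x ^ (-p) * (1 + x) ^ (-p))) (hint.const_mul _) ?_ ?_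
    · refine h.congr fun k => tsum_mul_left
    · filter_upwards [eventually_gt_atTop 0] with k hk x hx
      have hk' : (0 : ℝ) < k := by exact_mod_cast hk
      have hfl := Nat.lt_floor_add_one ((k : ℝ) * x)
      rw [key k hk, abs_mul, abs_mul, abs_mul, abs_of_pos (Real.rpow_pos_of_pos hk' p)]
      have h1 := rpow_mul_abs_le_of_bound (by linarith) hM hbd hx (k := k) (m := ⌊(k : ℝ) * x⌋₊)
        hfl.le
      have h2 := rpow_mul_abs_le_of_bound (by linarith) hM hbd (y := 1 + x) (by linarith) (k := k)
        (m := ⌊(k : ℝ) * x⌋₊ + k) (by push_cast; linarith)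
      calc _ ≤ (M * x ^ (-p)) * (M * (1 + x) ^ (-p)) := by gcongr
        _ = _ := by ring
    · refine (ae_restrict_iff' measurableSet_Ioi).2 (Eventually.of_forall fun x hx => ?_)
      have hx0 : (0 : ℝ) < x := hx
      have h1 := tendsto_mul_rpow_of_ratio hx0 hb (tendsto_floor_div hx0.le)
      have h2 := tendsto_mul_rpow_of_ratio (y := 1 + x) (by linarith) hb
        (m := fun k => ⌊(k : ℝ) * x⌋₊ + k) (by
          refine ((tendsto_floor_div hx0.le).const_add 1).congr' ?_
          filter_upwards [eventually_gt_atTop 0] with k hk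
          have : (k : ℝ) ≠ 0 := by positivity
          push_cast
          field_simp
          ring)
      have h3 := h1.mul h2
      have e : C * x ^ (-p) * (C * (1 + x) ^ (-p)) = C ^ 2 * (x ^ (-p) * (1 + x) ^ (-p)) := by ring
      rw [e] at h3
      refine h3.congr' ?_
      filter_upwards [eventually_gt_atTop 0] with k hk
      rw [key k hk]

theorem sum_Icc_intCast_eq_sum_range {M : Type*} [AddCommMonoid M] (f : ℤ → M) (n : ℕ) :
    ∑ t ∈ Finset.Icc (1 : ℤ) n, f t = ∑ i ∈ Finset.range n, f (i + 1) := by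
  symm
  refine Finset.sum_bij (fun i _ => (i : ℤ) + 1) ?_ ?_ ?_ ?_
  · intro i hi; simp only [Finset.mem_range] at hi; simp only [Finset.mem_Icc]; omega
  · intro i _ j _ h; simpa using h
  · intro t ht
    simp only [Finset.mem_Icc] at ht
    exact ⟨(t - 1).toNat, by simp only [Finset.mem_range]; omega, by omega⟩
  · intros; rfl

/-- Summing a function of `|s - t|` over a square along its diagonals. -/
theorem sum_sum_natAbs_sub (g : ℕ → ℝ) (n : ℕ) :
    ∑ s ∈ Finset.Icc (1 : ℤ) n, ∑ t ∈ Finset.Icc (1 : ℤ) n, g (s - t).natAbs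
      = 2 * ∑ k ∈ Finset.range n, ((n : ℝ) - k) * g k - n * g 0 := by
  simp_rw [sum_Icc_intCast_eq_sum_range]
  induction n with
  | zero => simp
  | succ n ih =>
    have hrow : ∑ j ∈ Finset.range n, g (((j : ℤ) + 1) - ((n : ℤ) + 1)).natAbs
        = ∑ k ∈ Finset.range (n + 1), g k - g 0 := by
      rw [Finset.sum_range_succ', add_sub_cancel_right,
        ← Finset.sum_range_reflect (fun k => g (k + 1))]
      refine Finset.sum_congr rfl fun j hj => ?_
      have := Finset.mem_range.1 hj
      congr 1; omega
    have hcol : ∑ j ∈ Finset.range n, g (((n : ℤ) + 1) - ((j : ℤ) + 1)).natAbs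
        = ∑ k ∈ Finset.range (n + 1), g k - g 0 := by
      rw [← hrow]
      refine Finset.sum_congr rfl fun j _ => ?_
      congr 1; omega
    have hlast : ∑ k ∈ Finset.range (n + 1), (((n + 1 : ℕ) : ℝ) - k) * g k
        = ∑ k ∈ Finset.range n, ((n : ℝ) - k) * g k + ∑ k ∈ Finset.range (n + 1), g k := by
      have : ∑ k ∈ Finset.range n, ((n : ℝ) - k) * g k
          = ∑ k ∈ Finset.range (n + 1), ((n : ℝ) - k) * g k := by
        rw [Finset.sum_range_succ]; simp
      rw [this, ← Finset.sum_add_distrib]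
      refine Finset.sum_congr rfl fun k _ => ?_
      push_cast; ring
    rw [Finset.sum_range_succ, Finset.sum_range_succ, hlast]
    simp_rw [Finset.sum_range_succ (fun x : ℕ => g (_ - ((x : ℤ) + 1)).natAbs)]
    rw [Finset.sum_add_distrib, ih, hrow, hcol]
    simp only [sub_self, Int.natAbs_zero]
    push_cast
    ring

/-- If `g k ∼ K k^{-r}` with `0 < r < 1`, then
`∑_{s,t ≤ n} g |s - t| ∼ 2 K n^{2-r} / ((1 - r) (2 - r))`. -/
theorem tendsto_sum_sum_natAbs_sub {g : ℕ → ℝ} {r K : ℝ} (hr : 0 < r) (hr' : r < 1)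
    (hg : Tendsto (fun k : ℕ => g k * (k : ℝ) ^ r) atTop (𝓝 K)) :
    Tendsto (fun n : ℕ => (n : ℝ) ^ (-(2 - r)) *
      ∑ s ∈ Finset.Icc (1 : ℤ) n, ∑ t ∈ Finset.Icc (1 : ℤ) n, g (s - t).natAbs) atTop
      (𝓝 (2 * (K / ((1 - r) * (2 - r))))) := by
  obtain ⟨M, hM, hbd⟩ := exists_bound_of_tendsto_mul_rpow hg
  have hkey : ∀ n : ℕ, 0 < n → ∀ m : ℕ, (n : ℝ) * ((n : ℝ) ^ (-(2 - r)) * (((n : ℝ) - m) * g m))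
      = (1 - (m : ℝ) / n) * ((n : ℝ) ^ r * g m) := by
    intro n hn m
    have hn' : (0 : ℝ) < n := by exact_mod_cast hn
    have : (n : ℝ) ^ (-(2 - r)) = (n : ℝ) ^ r / (n : ℝ) ^ 2 := by
      rw [show -(2 - r) = r - (2 : ℕ) by push_cast; ring, Real.rpow_sub_natCast hn'.ne']
    rw [this]
    field_simp
  have hint : IntegrableOn (fun x : ℝ => (Set.Ioo (0 : ℝ) 1).indicator (fun x => M * x ^ (-r)) x)
      (Set.Ioi 0) := by
    refine Integrable.integrableOn ?_
    rw [integrable_indicator_iff measurableSet_Ioo]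
    refine Integrable.const_mul ?_ M
    have h : IntegrableOn (fun x : ℝ => x ^ (-r)) (Set.Ioc 0 1) := by
      rw [← intervalIntegrable_iff_integrableOn_Ioc_of_le zero_le_one]
      exact intervalIntegral.intervalIntegrable_rpow' (by linarith)
    exact h.mono_set Set.Ioo_subset_Ioc_self
  have h := tendsto_tsum_of_riemann
    (F := fun n j => if j < n then (n : ℝ) ^ (-(2 - r)) * (((n : ℝ) - j) * g j) else 0)
    (g := fun x => (Set.Ioo (0 : ℝ) 1).indicator (fun x => K * (x ^ (-r) - x ^ (1 - r))) x)
    hint ?_ ?_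
  · have hval : ∫ x in Set.Ioi (0 : ℝ),
        (Set.Ioo (0 : ℝ) 1).indicator (fun x => K * (x ^ (-r) - x ^ (1 - r))) x
        = K / ((1 - r) * (2 - r)) := by
      rw [setIntegral_indicator measurableSet_Ioo,
        Set.inter_eq_right.2 (show Set.Ioo (0 : ℝ) 1 ⊆ Set.Ioi 0 from fun x hx => hx.1),
        ← integral_Ioc_eq_integral_Ioo, ← intervalIntegral.integral_of_le zero_le_one,
        intervalIntegral.integral_const_mul, intervalIntegral.integral_sub
          (intervalIntegral.intervalIntegrable_rpow' (by linarith))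
          (intervalIntegral.intervalIntegrable_rpow' (by linarith)),
        integral_rpow (Or.inl (by linarith)), integral_rpow (Or.inl (by linarith))]
      have h1 : 1 - r ≠ 0 := by linarith
      have h2 : 2 - r ≠ 0 := by linarith
      rw [Real.one_rpow, Real.one_rpow, Real.zero_rpow (by linarith), Real.zero_rpow (by linarith)]
      rw [show -r + 1 = 1 - r by ring, show 1 - r + 1 = 2 - r by ring]
      field_simp
      ring
    rw [hval] at h
    have h0 : Tendsto (fun n : ℕ => (n : ℝ) ^ (-(1 - r)) * g 0) atTop (𝓝 (0 * g 0)) :=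
      (((tendsto_rpow_neg_atTop (by linarith : 0 < 1 - r)).comp
        (tendsto_natCast_atTop_atTop (R := ℝ)))).mul_const _
    have h1 := (h.const_mul 2).sub h0
    rw [zero_mul, sub_zero] at h1
    refine h1.congr' ?_
    filter_upwards [eventually_gt_atTop 0] with n hn
    have hn' : (0 : ℝ) < n := by exact_mod_cast hn
    have hts : ∑' j, (if j < n then (n : ℝ) ^ (-(2 - r)) * (((n : ℝ) - j) * g j) else 0)
        = (n : ℝ) ^ (-(2 - r)) * ∑ k ∈ Finset.range n, ((n : ℝ) - k) * g k := by
      rw [tsum_eq_sum (s := Finset.range n) (fun j hj => if_neg (by simpa using hj)),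
        Finset.mul_sum]
      exact Finset.sum_congr rfl fun j hj => if_pos (Finset.mem_range.1 hj)
    have he : (n : ℝ) ^ (-(1 - r)) = (n : ℝ) ^ (-(2 - r)) * n := by
      nth_rewrite 3 [← Real.rpow_one (n : ℝ)]
      rw [← Real.rpow_add hn']; ring_nf
    rw [hts, sum_sum_natAbs_sub, he]
    ring
  · filter_upwards [eventually_gt_atTop 0] with n hn x hx
    have hn' : (0 : ℝ) < n := by exact_mod_cast hn
    have hfl := Nat.lt_floor_add_one ((n : ℝ) * x)
    by_cases hlt : ⌊(n : ℝ) * x⌋₊ < n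
    · have hx1 : x < 1 := by
        by_contra hx1
        have : n ≤ ⌊(n : ℝ) * x⌋₊ := Nat.le_floor (by nlinarith [not_lt.1 hx1])
        omega
      rw [if_pos hlt, Set.indicator_of_mem (show x ∈ Set.Ioo (0 : ℝ) 1 from ⟨hx, hx1⟩),
        hkey n hn, abs_mul, abs_mul, abs_of_pos (Real.rpow_pos_of_pos hn' r)]
      have h1 := rpow_mul_abs_le_of_bound hr.le hM hbd hx (k := n) (m := ⌊(n : ℝ) * x⌋₊) hfl.le
      have h2 : |1 - (⌊(n : ℝ) * x⌋₊ : ℝ) / n| ≤ 1 := by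
        have h3 : (⌊(n : ℝ) * x⌋₊ : ℝ) / n ≤ 1 := by
          rw [div_le_one hn']; exact_mod_cast hlt.le
        have h4 : 0 ≤ (⌊(n : ℝ) * x⌋₊ : ℝ) / n := by positivity
        rw [abs_le]; constructor <;> linarith
      calc _ ≤ 1 * (M * x ^ (-r)) := by gcongr
        _ = _ := one_mul _
    · rw [if_neg hlt, mul_zero, abs_zero]
      exact Set.indicator_nonneg (fun y hy => mul_nonneg hM (Real.rpow_nonneg hy.1.le _)) x
  · rw [ae_restrict_iff' measurableSet_Ioi]
    filter_upwards [compl_mem_ae_iff.2 (measure_singleton (1 : ℝ))] with x hx1 hx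
    have hx0 : (0 : ℝ) < x := hx
    have hfd := tendsto_floor_div hx0.le
    rcases lt_or_gt_of_ne (show x ≠ 1 from hx1) with hlt | hgt
    · rw [Set.indicator_of_mem (show x ∈ Set.Ioo (0 : ℝ) 1 from ⟨hx0, hlt⟩)]
      have h1 := (hfd.const_sub 1).mul (tendsto_mul_rpow_of_ratio hx0 hg hfd)
      have e : (1 - x) * (K * x ^ (-r)) = K * (x ^ (-r) - x ^ (1 - r)) := by
        rw [show 1 - r = 1 + -r by ring, Real.rpow_add hx0, Real.rpow_one]; ring
      rw [e] at h1
      refine h1.congr' ?_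
      filter_upwards [eventually_gt_atTop 0] with n hn
      have hn' : (0 : ℝ) < n := by exact_mod_cast hn
      have hl : ⌊(n : ℝ) * x⌋₊ < n := by
        rw [Nat.floor_lt (by positivity)]
        nlinarith
      rw [if_pos hl, hkey n hn]
    · rw [Set.indicator_of_notMem (fun h => absurd h.2 (not_lt.2 hgt.le))]
      refine tendsto_const_nhds.congr' ?_
      filter_upwards with n
      rw [if_neg, mul_zero]
      rw [not_lt]
      exact Nat.le_floor (by nlinarith [(Nat.cast_nonneg n : (0 : ℝ) ≤ n)])

/-! ### A central limit theorem for weighted sums -/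

theorem norm_prod_sub_prod_le {ι : Type*} (s : Finset ι) (a b : ι → ℂ) (ha : ∀ i ∈ s, ‖a i‖ ≤ 1)
    (hb : ∀ i ∈ s, ‖b i‖ ≤ 1) : ‖∏ i ∈ s, a i - ∏ i ∈ s, b i‖ ≤ ∑ i ∈ s, ‖a i - b i‖ := by
  classical
  induction s using Finset.induction_on with
  | empty => simp
  | insert i s hi ih =>
    rw [Finset.prod_insert hi, Finset.prod_insert hi, Finset.sum_insert hi]
    have h1 := ih (fun j hj => ha j (Finset.mem_insert_of_mem hj))
      (fun j hj => hb j (Finset.mem_insert_of_mem hj))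
    have h2 : ‖∏ j ∈ s, b j‖ ≤ 1 := (Finset.norm_prod_le _ _).trans
      (Finset.prod_le_one (fun _ _ => norm_nonneg _)
        (fun j hj => hb j (Finset.mem_insert_of_mem hj)))
    have h3 := ha i (Finset.mem_insert_self i s)
    calc ‖a i * ∏ j ∈ s, a j - b i * ∏ j ∈ s, b j‖
        = ‖a i * (∏ j ∈ s, a j - ∏ j ∈ s, b j) + (a i - b i) * ∏ j ∈ s, b j‖ := by
          congr 1; ring
      _ ≤ ‖a i‖ * ‖∏ j ∈ s, a j - ∏ j ∈ s, b j‖ + ‖a i - b i‖ * ‖∏ j ∈ s, b j‖ := by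
          rw [← norm_mul, ← norm_mul]; exact norm_add_le _ _
      _ ≤ 1 * (∑ j ∈ s, ‖a j - b j‖) + ‖a i - b i‖ * 1 := by gcongr
      _ = _ := by ring

/-- The characteristic function of a standardized law agrees with that of `N(0,1)` up to
`o(t²)`. -/
theorem charFun_sub_gaussian_isLittleO {Ω : Type*} [MeasurableSpace Ω] {P : Measure Ω}
    [IsProbabilityMeasure P] {ξ : Ω → ℝ} (hm : AEMeasurable ξ P) (h0 : P[ξ] = 0)
    (h1 : P[ξ ^ 2] = 1) :
    (fun t : ℝ => charFun (P.map ξ) t - Complex.exp (-(t : ℂ) ^ 2 / 2)) =o[𝓝 0]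
      fun t : ℝ => t ^ 2 := by
  have hg := taylor_charFun_two (P := gaussianReal 0 1) (X := id) aemeasurable_id (by simp) (by
    have h := variance_eq_integral (μ := gaussianReal 0 1) (X := id) aemeasurable_id
    rw [variance_id_gaussianReal] at h
    simpa using h.symm)
  refine ((taylor_charFun_two hm h0 h1).sub hg).congr_left fun t => ?_
  rw [Measure.map_id, charFun_gaussianReal]
  simp only [Complex.ofReal_zero, mul_zero, zero_mul, zero_sub, NNReal.coe_one, Complex.ofReal_one,
    one_mul]
  rw [neg_div]
  ring

/-- Central limit theorem for weighted sums of i.i.d. standardized variables: if the weights are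
uniformly small and their squares sum to `v` in the limit, the sums are asymptotically
`N(0, v)`. -/
theorem tendstoInDistribution_weighted_sum {Ω ι : Type*} [MeasurableSpace Ω] {P : Measure Ω}
    [IsProbabilityMeasure P] {ε : ι → Ω → ℝ} {ξ : Ω → ℝ} (hindep : iIndepFun ε P)
    (hident : ∀ i, IdentDistrib (ε i) ξ P P) (h0 : P[ξ] = 0) (h1 : P[ξ ^ 2] = 1)
    (s : ℕ → Finset ι) (c : ℕ → ι → ℝ) {v : ℝ} (hv : 0 ≤ v)
    (hc : Tendsto (fun n => ∑ i ∈ s n, c n i ^ 2) atTop (𝓝 v)) {δ : ℕ → ℝ}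
    (hδ : Tendsto δ atTop (𝓝 0)) (hcδ : ∀ n, ∀ i ∈ s n, |c n i| ≤ δ n) :
    TendstoInDistribution (fun n ω => ∑ i ∈ s n, c n i * ε i ω) atTop (fun z : ℝ => z)
      (fun _ => P) (gaussianReal 0 v.toNNReal) := by
  have hm : ∀ i, AEMeasurable (ε i) P := fun i => (hident i).aemeasurable_fst
  refine ⟨fun n => Finset.aemeasurable_fun_sum _ fun i _ => (hm i).const_mul _, by fun_prop, ?_⟩
  refine ProbabilityMeasure.tendsto_iff_tendsto_charFun.2 fun t => ?_
  have hmap : (gaussianReal 0 v.toNNReal).map (fun z : ℝ => z) = gaussianReal 0 v.toNNReal :=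
    Measure.map_id
  simp only [ProbabilityMeasure.coe_mk, hmap]
  set φ : ℝ → ℂ := charFun (P.map ξ) with hφ
  have hchar : ∀ n, charFun (P.map fun ω => ∑ i ∈ s n, c n i * ε i ω) t
      = ∏ i ∈ s n, φ (c n i * t) := by
    intro n
    have hi : iIndepFun (fun i ω => c n i * ε i ω) P :=
      hindep.comp (fun i x => c n i * x) (fun i => by fun_prop)
    rw [iIndepFun.charFun_map_fun_finsetSum_eq_prod (fun i _ => (hm i).const_mul _)
      (hi.restrict _), Finset.prod_apply]
    exact Finset.prod_congr rfl fun i _ => by rw [charFun_map_mul_comp (hm i), (hident i).map_eq]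
  simp only [hchar]
  have hgauss : Tendsto (fun n => ∏ i ∈ s n, Complex.exp (-((c n i * t : ℝ) : ℂ) ^ 2 / 2)) atTop
      (𝓝 (charFun (gaussianReal 0 v.toNNReal) t)) := by
    have e : ∀ n, ∏ i ∈ s n, Complex.exp (-((c n i * t : ℝ) : ℂ) ^ 2 / 2)
        = Complex.exp (-((∑ i ∈ s n, c n i ^ 2 : ℝ) : ℂ) * (t : ℂ) ^ 2 / 2) := by
      intro n
      rw [← Complex.exp_sum]
      congr 1
      push_cast
      rw [neg_mul, Finset.sum_mul, ← Finset.sum_neg_distrib, Finset.sum_div]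
      exact Finset.sum_congr rfl fun i _ => by ring
    simp only [e, charFun_gaussianReal]
    refine (Complex.continuous_exp.tendsto _).comp ?_
    have : (t : ℂ) * ((0 : ℝ) : ℂ) * Complex.I - ((v.toNNReal : ℝ) : ℂ) * (t : ℂ) ^ 2 / 2
        = -(v : ℂ) * (t : ℂ) ^ 2 / 2 := by
      rw [Real.coe_toNNReal _ hv]; push_cast; ring
    rw [this]
    exact (((Complex.continuous_ofReal.tendsto _).comp hc).neg.mul_const _).div_const _
  refine tendsto_of_tendsto_of_dist hgauss ?_
  rcases isEmpty_or_nonempty ι with hι | ⟨⟨i₀⟩⟩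
  · simp [Finset.eq_empty_of_isEmpty]
  have hmξ : AEMeasurable ξ P := (hident i₀).aemeasurable_snd
  have : IsProbabilityMeasure (P.map ξ) := Measure.isProbabilityMeasure_map hmξ
  have hlo := charFun_sub_gaussian_isLittleO hmξ h0 h1
  rw [Metric.tendsto_nhds]
  intro η hη
  -- `κ` makes the total error `κ t² ∑ c²` smaller than `η`
  set κ : ℝ := η / (t ^ 2 * (v + 1) + 1) with hκ
  have hD : 0 < t ^ 2 * (v + 1) + 1 := by positivity
  have hκ0 : 0 < κ := by positivity
  have hev := hlo.def hκ0
  obtain ⟨r, hr, hball⟩ := Metric.eventually_nhds_iff.1 hev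
  have hδt : Tendsto (fun n => δ n * |t|) atTop (𝓝 0) := by simpa using hδ.mul_const |t|
  filter_upwards [hδt.eventually (gt_mem_nhds hr),
    hc.eventually (gt_mem_nhds (show v < v + 1 by linarith))] with n hn hcn
  rw [Real.dist_0_eq_abs, abs_of_nonneg dist_nonneg, dist_comm, dist_eq_norm]
  have hexp : ∀ x : ℝ, ‖Complex.exp (-(x : ℂ) ^ 2 / 2)‖ ≤ 1 := by
    intro x
    rw [Complex.norm_exp]
    have : (-(x : ℂ) ^ 2 / 2).re = -(x ^ 2 / 2) := by
      rw [show -(x : ℂ) ^ 2 / 2 = ((-(x ^ 2 / 2) : ℝ) : ℂ) by push_cast; ring, Complex.ofReal_re]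
    rw [this, Real.exp_le_one_iff]
    have := sq_nonneg x
    linarith
  calc _ ≤ ∑ i ∈ s n, ‖φ (c n i * t) - Complex.exp (-((c n i * t : ℝ) : ℂ) ^ 2 / 2)‖ :=
        norm_prod_sub_prod_le _ _ _ (fun i _ => norm_charFun_le_one _) (fun i _ => hexp _)
    _ ≤ ∑ i ∈ s n, κ * (t ^ 2 * c n i ^ 2) := by
        refine Finset.sum_le_sum fun i hi => ?_
        have hd : dist (c n i * t) 0 < r := by
          rw [Real.dist_0_eq_abs, abs_mul]
          exact (mul_le_mul_of_nonneg_right (hcδ n i hi) (abs_nonneg t)).trans_lt hn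
        refine (hball hd).trans_eq ?_
        rw [Real.norm_of_nonneg (sq_nonneg _)]; ring
    _ = κ * (t ^ 2 * ∑ i ∈ s n, c n i ^ 2) := by rw [Finset.mul_sum, Finset.mul_sum]
    _ ≤ κ * (t ^ 2 * (v + 1)) := by gcongr
    _ < κ * (t ^ 2 * (v + 1) + 1) := by gcongr; linarith
    _ = η := by rw [hκ]; field_simp

/-! ### Second order structure of moving averages -/

section SquareIntegrable

variable {Ω : Type*} [MeasurableSpace Ω] {P : Measure Ω}

theorem tendsto_integral_mul_of_tendsto_eLpNorm {f g : ℕ → Ω → ℝ} {F G : Ω → ℝ}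
    (hf : ∀ n, MemLp (f n) 2 P) (hg : ∀ n, MemLp (g n) 2 P) (hF : MemLp F 2 P) (hG : MemLp G 2 P)
    (hfF : Tendsto (fun n => eLpNorm (f n - F) 2 P) atTop (𝓝 0))
    (hgG : Tendsto (fun n => eLpNorm (g n - G) 2 P) atTop (𝓝 0)) :
    Tendsto (fun n => ∫ ω, f n ω * g n ω ∂P) atTop (𝓝 (∫ ω, F ω * G ω ∂P)) := by
  have h1 : Tendsto (fun n => (hf n).toLp (f n)) atTop (𝓝 (hF.toLp F)) :=
    (Lp.tendsto_Lp_iff_tendsto_eLpNorm'' f hf F hF).2 hfF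
  have h2 : Tendsto (fun n => (hg n).toLp (g n)) atTop (𝓝 (hG.toLp G)) :=
    (Lp.tendsto_Lp_iff_tendsto_eLpNorm'' g hg G hG).2 hgG
  have h3 := h1.inner (𝕜 := ℝ) h2
  have e : ∀ {a c : Ω → ℝ} (ha : MemLp a 2 P) (hc : MemLp c 2 P),
      inner ℝ (ha.toLp a) (hc.toLp c) = ∫ ω, a ω * c ω ∂P := by
    intro a c ha hc
    rw [L2.inner_def]
    refine integral_congr_ae ?_
    filter_upwards [ha.coeFn_toLp, hc.coeFn_toLp] with ω h h'
    rw [h, h']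
    simp [mul_comm]
  simpa only [e] using h3

end SquareIntegrable

section MovingAverage

variable {Ω : Type*} [MeasurableSpace Ω] {P : Measure Ω}
  {ε u : ℤ → Ω → ℝ} {b : ℕ → ℝ}

namespace IsStandardizedIID

theorem memLp_eval (hε : IsStandardizedIID ε P) (t : ℤ) : MemLp (ε t) 2 P :=
  (hε.identDistrib t).memLp_iff.2 hε.memLp

theorem integral_eval (hε : IsStandardizedIID ε P) (t : ℤ) : ∫ ω, ε t ω ∂P = 0 :=
  (hε.identDistrib t).integral_eq.trans hε.mean_zero

theorem integral_sq [IsProbabilityMeasure P] (hε : IsStandardizedIID ε P) :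
    ∫ ω, (ε 0 ^ 2) ω ∂P = 1 := by
  have h := variance_eq_sub hε.memLp
  rw [hε.variance_one, hε.mean_zero] at h
  simpa using h.symm

theorem integral_mul [IsProbabilityMeasure P] (hε : IsStandardizedIID ε P) (s t : ℤ) :
    ∫ ω, ε s ω * ε t ω ∂P = if s = t then 1 else 0 := by
  split_ifs with h
  · subst h
    rw [← hε.integral_sq]
    have := ((hε.identDistrib s).comp (u := fun x : ℝ => x ^ 2) (by fun_prop)).integral_eq
    simpa [Function.comp_def, sq] using this
  · rw [(hε.indep.indepFun h).integral_fun_mul_eq_mul_integral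
      (hε.measurable s).aestronglyMeasurable (hε.measurable t).aestronglyMeasurable,
      hε.integral_eval, zero_mul]

theorem integral_sum_mul_sum [IsProbabilityMeasure P] (hε : IsStandardizedIID ε P)
    {κ κ' : Type*} (A : Finset κ) (B : Finset κ') (a : κ → ℝ) (c : κ' → ℝ) (f : κ → ℤ)
    (g : κ' → ℤ) :
    ∫ ω, (∑ i ∈ A, a i * ε (f i) ω) * (∑ j ∈ B, c j * ε (g j) ω) ∂P
      = ∑ i ∈ A, ∑ j ∈ B, if f i = g j then a i * c j else 0 := by
  have hint : ∀ i j, Integrable (fun ω => a i * ε (f i) ω * (c j * ε (g j) ω)) P := fun i j =>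
    ((hε.memLp_eval (f i)).const_mul (a i)).integrable_mul ((hε.memLp_eval (g j)).const_mul (c j))
  simp_rw [Finset.sum_mul_sum]
  rw [integral_finsetSum _ fun i _ => integrable_finsetSum _ fun j _ => hint i j]
  refine Finset.sum_congr rfl fun i _ => ?_
  rw [integral_finsetSum _ fun j _ => hint i j]
  refine Finset.sum_congr rfl fun j _ => ?_
  have : ∀ ω, a i * ε (f i) ω * (c j * ε (g j) ω) = (a i * c j) * (ε (f i) ω * ε (g j) ω) :=
    fun ω => by ring
  simp_rw [this, integral_const_mul, hε.integral_mul]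
  simp

end IsStandardizedIID

/-- The moving average truncated to the `N` most recent innovations. -/
def maPartial {Ω : Type*} (b : ℕ → ℝ) (ε : ℤ → Ω → ℝ) (N : ℕ) (t : ℤ) (ω : Ω) : ℝ :=
  ∑ j ∈ Finset.range N, b j * ε (t - j) ω

theorem memLp_maPartial (hε : IsStandardizedIID ε P) (N : ℕ) (t : ℤ) :
    MemLp (maPartial b ε N t) 2 P :=
  memLp_finsetSum _ fun j _ => (hε.memLp_eval (t - j)).const_mul (b j)

theorem tendsto_eLpNorm_maPartial_sub (hu : IsMovingAverage b ε u P) (t : ℤ) :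
    Tendsto (fun N => eLpNorm (maPartial b ε N t - u t) 2 P) atTop (𝓝 0) := by
  refine (hu.tendsto t).congr fun N => ?_
  rw [eLpNorm_sub_comm]
  rfl

theorem IsMovingAverage.memLp (hε : IsStandardizedIID ε P) (hu : IsMovingAverage b ε u P) (t : ℤ) :
    MemLp (u t) 2 P := by
  obtain ⟨N, hN⟩ := ((tendsto_eLpNorm_maPartial_sub hu t).eventually
    (gt_mem_nhds (show (0 : ENNReal) < 1 by simp))).exists
  have h1 : MemLp (maPartial b ε N t - u t) 2 P :=
    ⟨(memLp_maPartial hε N t).1.sub (hu.aestronglyMeasurable t), hN.trans ENNReal.one_lt_top⟩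
  simpa only [sub_sub_cancel] using (memLp_maPartial (b := b) hε N t).sub h1

theorem IsMovingAverage.integral_eq_zero [IsProbabilityMeasure P] (hε : IsStandardizedIID ε P)
    (hu : IsMovingAverage b ε u P) (t : ℤ) : ∫ ω, u t ω ∂P = 0 := by
  have h1 : MemLp (fun _ : Ω => (1 : ℝ)) 2 P := memLp_const 1
  have h := tendsto_integral_mul_of_tendsto_eLpNorm (fun N => memLp_maPartial (b := b) hε N t)
    (fun _ => h1) (hu.memLp hε t) h1 (tendsto_eLpNorm_maPartial_sub hu t) (by simp)
  simp only [mul_one] at h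
  refine tendsto_nhds_unique h (tendsto_const_nhds.congr fun N => ?_)
  simp only [maPartial]
  rw [integral_finsetSum _ fun (j : ℕ) _ =>
    ((hε.memLp_eval (t - j)).const_mul (b j)).integrable one_le_two]
  simp [integral_const_mul, hε.integral_eval]

theorem IsMovingAverage.integral_mul_shift [IsProbabilityMeasure P] (hε : IsStandardizedIID ε P)
    (hu : IsMovingAverage b ε u P) (hb : Summable fun j => b j ^ 2) (t : ℤ) (k : ℕ) :
    ∫ ω, u t ω * u (t + k) ω ∂P = ∑' j, b j * b (j + k) := by
  have h := tendsto_integral_mul_of_tendsto_eLpNorm (fun N => memLp_maPartial (b := b) hε N t)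
    (fun N => memLp_maPartial (b := b) hε N (t + k)) (hu.memLp hε t) (hu.memLp hε (t + k))
    (tendsto_eLpNorm_maPartial_sub hu t) (tendsto_eLpNorm_maPartial_sub hu (t + k))
  have hs : Summable fun j => b j * b (j + k) := by
    have hb' : Summable fun j => b (j + k) ^ 2 := (summable_nat_add_iff k).2 hb
    refine Summable.of_norm_bounded (hb.add hb') fun j => ?_
    rw [Real.norm_eq_abs, abs_mul, ← sq_abs (b j), ← sq_abs (b (j + k))]
    nlinarith [sq_nonneg (|b j| - |b (j + k)|), sq_nonneg (|b j| + |b (j + k)|)]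
  refine tendsto_nhds_unique h ?_
  refine (hs.hasSum.tendsto_sum_nat.comp (tendsto_sub_atTop_nat k)).congr fun N => ?_
  simp only [Function.comp, maPartial]
  rw [hε.integral_sum_mul_sum]
  have hcond : ∀ i j : ℕ, (t - (i : ℤ) = t + k - (j : ℤ)) ↔ j = i + k := by
    intro i j; omega
  simp_rw [hcond, Finset.sum_ite_eq', Finset.mem_range]
  rw [← Finset.sum_filter]
  refine Finset.sum_congr ?_ fun _ _ => rfl
  ext i
  simp only [Finset.mem_range, Finset.mem_filter]
  omega

theorem IsMovingAverage.autoCov_eq [IsProbabilityMeasure P] (hε : IsStandardizedIID ε P)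
    (hu : IsMovingAverage b ε u P) (hb : Summable fun j => b j ^ 2) (k : ℕ) :
    autoCov u P k = ∑' j, b j * b (j + k) := by
  rw [autoCov, covariance_eq_sub (hu.memLp hε 0) (hu.memLp hε k), hu.integral_eq_zero hε, zero_mul,
    sub_zero, ← hu.integral_mul_shift hε hb 0 k]
  simp

theorem IsMovingAverage.integral_mul [IsProbabilityMeasure P] (hε : IsStandardizedIID ε P)
    (hu : IsMovingAverage b ε u P) (hb : Summable fun j => b j ^ 2) (s t : ℤ) :
    ∫ ω, u s ω * u t ω ∂P = autoCov u P (s - t).natAbs := by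
  rw [hu.autoCov_eq hε hb]
  rcases le_total s t with h | h
  · rw [← hu.integral_mul_shift hε hb s]
    have : s + ((s - t).natAbs : ℤ) = t := by omega
    rw [this]
  · rw [← hu.integral_mul_shift hε hb t]
    have : t + ((s - t).natAbs : ℤ) = s := by omega
    rw [this]
    simp_rw [mul_comm]

/-- A moving average is, almost surely, a measurable functional of its innovations; hence pairs of
its values are independent of anything the innovations are independent of. -/
theorem IsMovingAverage.indepFun_prodMk (hε : IsStandardizedIID ε P)
    (hu : IsMovingAverage b ε u P) {S : Type*} [MeasurableSpace S] {V : Ω → S}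
    (hV : IndepFun (fun ω t => ε t ω) V P) (s t : ℤ) :
    IndepFun (fun ω => (u s ω, u t ω)) V P := by
  have hrep : ∀ t : ℤ, ∃ Φ : (ℤ → ℝ) → ℝ, Measurable Φ ∧
      (fun ω => Φ (fun t => ε t ω)) =ᵐ[P] u t := by
    intro t
    have hme := tendstoInMeasure_of_tendsto_eLpNorm (two_ne_zero)
      (fun N => (memLp_maPartial (b := b) hε N t).1) (hu.aestronglyMeasurable t)
      (tendsto_eLpNorm_maPartial_sub hu t)
    obtain ⟨ns, -, hns⟩ := hme.exists_seq_tendsto_ae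
    refine ⟨fun e => limsup (fun i => ∑ j ∈ Finset.range (ns i), b j * e (t - j)) atTop,
      Measurable.limsup fun i => Finset.measurable_fun_sum _ fun j _ =>
        (measurable_pi_apply _).const_mul _, ?_⟩
    filter_upwards [hns] with ω hω
    exact hω.limsup_eq
  obtain ⟨Φ, hΦ, hΦu⟩ := hrep s
  obtain ⟨Ψ, hΨ, hΨu⟩ := hrep t
  refine (hV.comp (hΦ.prodMk hΨ) measurable_id).congr ?_ Filter.EventuallyEq.rfl
  filter_upwards [hΦu, hΨu] with ω h1 h2
  simp only [Function.comp, h1, h2]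

/-! ### The central limit theorem for partial sums of a moving average -/

/-- The weight of `ε i` in `∑_{t=1}^n u t`, the moving average being truncated at lag `N`. -/
noncomputable def sumWeight (b : ℕ → ℝ) (n N : ℕ) (i : ℤ) : ℝ :=
  ∑ j ∈ Finset.range N, if i + j ∈ Finset.Icc (1 : ℤ) n then b j else 0

theorem sum_maPartial_eq {Ω : Type*} {ε : ℤ → Ω → ℝ} (n N : ℕ) (ω : Ω) :
    ∑ t ∈ Finset.Icc (1 : ℤ) n, maPartial b ε N t ω
      = ∑ i ∈ Finset.Icc (1 - (N : ℤ)) n, sumWeight b n N i * ε i ω := by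
  simp only [maPartial, sumWeight, Finset.sum_mul]
  rw [Finset.sum_comm, Finset.sum_comm (s := Finset.Icc (1 - (N : ℤ)) n)]
  refine Finset.sum_congr rfl fun j hj => ?_
  have hj := Finset.mem_range.1 hj
  simp_rw [ite_mul, zero_mul]
  rw [← Finset.sum_filter]
  refine Finset.sum_bij (fun t _ => t - j) ?_ ?_ ?_ ?_
  · intro t ht
    simp only [Finset.mem_filter, Finset.mem_Icc] at ht ⊢
    omega
  · intro t _ t' _ h; omega
  · intro i hi
    simp only [Finset.mem_filter, Finset.mem_Icc] at hi
    exact ⟨i + j, by simp only [Finset.mem_Icc]; omega, by omega⟩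
  · intros; rfl

theorem abs_sumWeight_le (hb : HasSum (fun j => b j ^ 2) 1) (n N : ℕ) (i : ℤ) :
    |sumWeight b n N i| ≤ √n := by
  refine Real.abs_le_sqrt ?_
  have h := Finset.sum_mul_sq_le_sq_mul_sq (Finset.range N) b
    (fun j => if i + j ∈ Finset.Icc (1 : ℤ) n then (1 : ℝ) else 0)
  simp only [mul_ite, mul_one, mul_zero, ite_pow, one_pow, ne_eq, OfNat.ofNat_ne_zero,
    not_false_eq_true, zero_pow] at h
  refine h.trans ?_
  have h1 : ∑ j ∈ Finset.range N, b j ^ 2 ≤ 1 :=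
    sum_le_hasSum _ (fun j _ => sq_nonneg _) hb
  have h2 : (∑ j ∈ Finset.range N, if i + j ∈ Finset.Icc (1 : ℤ) n then (1 : ℝ) else 0) ≤ n := by
    rw [Finset.sum_boole]
    have hcard : (Finset.filter (fun j : ℕ => i + (j : ℤ) ∈ Finset.Icc (1 : ℤ) n)
        (Finset.range N)).card ≤ (Finset.Icc (1 : ℤ) n).card := by
      refine Finset.card_le_card_of_injOn (fun j : ℕ => i + (j : ℤ)) ?_ ?_
      · intro j hj
        exact (Finset.mem_filter.1 hj).2
      · intro j _ j' _ hjj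
        simpa using hjj
    rw [Int.card_Icc] at hcard
    exact_mod_cast hcard.trans (by omega)
  calc _ ≤ (1 : ℝ) * n := by
        refine mul_le_mul h1 h2 (Finset.sum_nonneg fun j _ => ?_) zero_le_one
        split_ifs <;> norm_num
    _ = n := one_mul _

theorem tendsto_eLpNorm_normalized_sum (hε : IsStandardizedIID ε P) (hu : IsMovingAverage b ε u P)
    (a : ℝ) (n : ℕ) :
    Tendsto (fun N => eLpNorm ((fun ω => a * ∑ t ∈ Finset.Icc (1 : ℤ) n, maPartial b ε N t ω)
      - fun ω => a * ∑ t ∈ Finset.Icc (1 : ℤ) n, u t ω) 2 P) atTop (𝓝 0) := by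
  have hsum : Tendsto (fun N => ‖a‖ₑ * ∑ t ∈ Finset.Icc (1 : ℤ) n,
      eLpNorm (maPartial b ε N t - u t) 2 P) atTop (𝓝 0) := by
    have h := tendsto_finsetSum (Finset.Icc (1 : ℤ) n)
      (fun t _ => tendsto_eLpNorm_maPartial_sub hu t)
    have h2 := ENNReal.Tendsto.const_mul (a := ‖a‖ₑ) h (Or.inr enorm_ne_top)
    simpa using h2
  refine tendsto_of_tendsto_of_tendsto_of_le_of_le tendsto_const_nhds hsum (fun _ => zero_le)
    fun N => ?_
  have e : ((fun ω => a * ∑ t ∈ Finset.Icc (1 : ℤ) n, maPartial b ε N t ω)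
      - fun ω => a * ∑ t ∈ Finset.Icc (1 : ℤ) n, u t ω)
      = a • ∑ t ∈ Finset.Icc (1 : ℤ) n, (maPartial b ε N t - u t) := by
    ext ω
    simp [Finset.sum_apply, mul_sub]
  rw [e, eLpNorm_const_smul]
  gcongr
  exact eLpNorm_sum_le (fun t _ => (memLp_maPartial hε N t).1.sub (hu.aestronglyMeasurable t))
    one_le_two

/-- If the variance of the normalized partial sums `n^{-H} ∑_{t=1}^n u t` of a moving average
converges, the sums are asymptotically normal. The individual weights are at most `n^{1/2-H}` by
the Cauchy–Schwarz inequality, which is what makes them negligible. -/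
theorem IsMovingAverage.tendstoInDistribution_sum [IsProbabilityMeasure P]
    (hε : IsStandardizedIID ε P) (hu : IsMovingAverage b ε u P)
    (hb : HasSum (fun j => b j ^ 2) 1) {H v : ℝ} (hH : 1 / 2 < H)
    (hv : 0 ≤ v)
    (hvar : Tendsto (fun n : ℕ => (n : ℝ) ^ (-(2 * H)) * ∑ s ∈ Finset.Icc (1 : ℤ) n,
      ∑ t ∈ Finset.Icc (1 : ℤ) n, autoCov u P (s - t).natAbs) atTop (𝓝 v)) :
    TendstoInDistribution
      (fun (n : ℕ) ω => (n : ℝ) ^ (-H) * ∑ t ∈ Finset.Icc (1 : ℤ) n, u t ω) atTop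
      (fun z : ℝ => z) (fun _ => P) (gaussianReal 0 v.toNNReal) := by
  set U : ℕ → Ω → ℝ := fun n ω => (n : ℝ) ^ (-H) * ∑ t ∈ Finset.Icc (1 : ℤ) n, u t ω with hU
  set V : ℕ → ℕ → Ω → ℝ := fun n N ω =>
    (n : ℝ) ^ (-H) * ∑ t ∈ Finset.Icc (1 : ℤ) n, maPartial b ε N t ω with hV
  have hUm : ∀ n, MemLp (U n) 2 P := fun n =>
    (memLp_finsetSum _ fun t _ => hu.memLp hε t).const_mul _
  have hVm : ∀ n N, MemLp (V n N) 2 P := fun n N =>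
    (memLp_finsetSum _ fun t _ => memLp_maPartial hε N t).const_mul _
  have hVU : ∀ n, Tendsto (fun N => eLpNorm (V n N - U n) 2 P) atTop (𝓝 0) := fun n =>
    tendsto_eLpNorm_normalized_sum hε hu _ n
  have hVU2 : ∀ n, Tendsto (fun N => ∫ ω, V n N ω * V n N ω ∂P) atTop
      (𝓝 (∫ ω, U n ω * U n ω ∂P)) := fun n =>
    tendsto_integral_mul_of_tendsto_eLpNorm (hVm n) (hVm n) (hUm n) (hUm n) (hVU n) (hVU n)
  have hchoice : ∀ n : ℕ, ∃ N, eLpNorm (V n N - U n) 2 P < ENNReal.ofReal (1 / ((n : ℝ) + 1)) ∧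
      |∫ ω, V n N ω * V n N ω ∂P - ∫ ω, U n ω * U n ω ∂P| < 1 / ((n : ℝ) + 1) := by
    intro n
    have hpos : (0 : ℝ) < 1 / ((n : ℝ) + 1) := by positivity
    refine (((hVU n).eventually (gt_mem_nhds (ENNReal.ofReal_pos.2 hpos))).and ?_).exists
    exact (Metric.tendsto_nhds.1 (hVU2 n) _ hpos)
  choose N hN1 hN2 using hchoice
  have hinv : Tendsto (fun n : ℕ => 1 / ((n : ℝ) + 1)) atTop (𝓝 0) :=
    tendsto_one_div_add_atTop_nhds_zero_nat
  have hUvar : ∀ n : ℕ, ∫ ω, U n ω * U n ω ∂P = (n : ℝ) ^ (-(2 * H)) *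
      ∑ s ∈ Finset.Icc (1 : ℤ) n, ∑ t ∈ Finset.Icc (1 : ℤ) n, autoCov u P (s - t).natAbs := by
    intro n
    have hint : ∀ s t, Integrable (fun ω => u s ω * u t ω) P := fun s t =>
      (hu.memLp hε s).integrable_mul (hu.memLp hε t)
    have e : ∀ ω, U n ω * U n ω = ((n : ℝ) ^ (-H) * (n : ℝ) ^ (-H)) *
        ∑ s ∈ Finset.Icc (1 : ℤ) n, ∑ t ∈ Finset.Icc (1 : ℤ) n, u s ω * u t ω := by
      intro ω
      rw [← Finset.sum_mul_sum]
      simp only [hU]; ring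
    have e2 : (n : ℝ) ^ (-H) * (n : ℝ) ^ (-H) = (n : ℝ) ^ (-(2 * H)) := by
      rw [← Real.rpow_add' (Nat.cast_nonneg n) (by linarith)]; ring_nf
    simp_rw [e]
    rw [integral_const_mul, e2, integral_finsetSum _ fun s _ =>
      integrable_finsetSum _ fun t _ => hint s t]
    congr 1
    refine Finset.sum_congr rfl fun s _ => ?_
    rw [integral_finsetSum _ fun t _ => hint s t]
    exact Finset.sum_congr rfl fun t _ => hu.integral_mul hε hb.summable s t
  have hVvar : Tendsto (fun n => ∫ ω, V n (N n) ω * V n (N n) ω ∂P) atTop (𝓝 v) := by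
    refine Filter.Tendsto.congr_dist (f₁ := fun n => ∫ ω, U n ω * U n ω ∂P) ?_ ?_
    · simpa only [hUvar] using hvar
    · refine squeeze_zero (fun _ => dist_nonneg) (fun n => ?_) hinv
      rw [dist_comm]
      exact (hN2 n).le
  have hVsum : ∀ n ω, V n (N n) ω = ∑ i ∈ Finset.Icc (1 - (N n : ℤ)) n,
      ((n : ℝ) ^ (-H) * sumWeight b n (N n) i) * ε i ω := by
    intro n ω
    simp only [hV]
    rw [sum_maPartial_eq, Finset.mul_sum]
    exact Finset.sum_congr rfl fun i _ => by ring
  have hclt : TendstoInDistribution (fun n => V n (N n)) atTop (fun z : ℝ => z) (fun _ => P)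
      (gaussianReal 0 v.toNNReal) := by
    have h := tendstoInDistribution_weighted_sum hε.indep hε.identDistrib hε.mean_zero
      hε.integral_sq (fun n => Finset.Icc (1 - (N n : ℤ)) n)
      (fun n i => (n : ℝ) ^ (-H) * sumWeight b n (N n) i) hv
      (δ := fun n : ℕ => (n : ℝ) ^ (-H) * √n) ?_ ?_ ?_
    · have e : (fun n => V n (N n)) = fun (n : ℕ) ω => ∑ i ∈ Finset.Icc (1 - (N n : ℤ)) n,
          ((n : ℝ) ^ (-H) * sumWeight b n (N n) i) * ε i ω := by
        funext n ω; exact hVsum n ω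
      rw [e]; exact h
    · refine hVvar.congr fun n => ?_
      simp_rw [hVsum]
      rw [hε.integral_sum_mul_sum]
      refine Finset.sum_congr rfl fun i hi => ?_
      rw [Finset.sum_ite_eq, if_pos hi, sq]
    · have h := (tendsto_rpow_neg_atTop (by linarith : 0 < H - 1 / 2)).comp
        (tendsto_natCast_atTop_atTop (R := ℝ))
      refine h.congr' ?_
      filter_upwards [eventually_gt_atTop 0] with n hn
      have hn' : (0 : ℝ) < n := by exact_mod_cast hn
      simp only [Function.comp]
      rw [Real.sqrt_eq_rpow, ← Real.rpow_add hn']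
      ring_nf
    · intro n i _
      rw [abs_mul, abs_of_nonneg (Real.rpow_nonneg (Nat.cast_nonneg n) _)]
      exact mul_le_mul_of_nonneg_left (abs_sumWeight_le hb n (N n) i) (by positivity)
  refine tendstoInDistribution_of_tendstoInMeasure_sub U _ hclt ?_
    (fun n => (hUm n).1.aemeasurable)
  refine tendstoInMeasure_of_tendsto_eLpNorm two_ne_zero
    (fun n => (hUm n).1.sub (hVm n (N n)).1) aestronglyMeasurable_zero ?_
  have hE : Tendsto (fun n : ℕ => ENNReal.ofReal (1 / ((n : ℝ) + 1))) atTop (𝓝 0) := by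
    simpa using ENNReal.tendsto_ofReal hinv
  refine tendsto_of_tendsto_of_tendsto_of_le_of_le tendsto_const_nhds hE (fun _ => zero_le)
    fun n => ?_
  simp only [sub_zero, Pi.sub_apply]
  rw [eLpNorm_sub_comm]
  exact (hN1 n).le

end MovingAverage

/-! ### Weakly correlated Gaussian pairs -/

/-- The density, with respect to `N(0,1) ⊗ N(0,1)`, of a standard Gaussian pair with
correlation `ρ`. -/
noncomputable def mehlerKernel (ρ x y : ℝ) : ℝ :=
  (√(1 - ρ ^ 2))⁻¹ * Real.exp (-((ρ ^ 2 * (x ^ 2 + y ^ 2) - 2 * ρ * x * y) / (2 * (1 - ρ ^ 2))))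

theorem mehlerKernel_nonneg (ρ x y : ℝ) : 0 ≤ mehlerKernel ρ x y := by
  unfold mehlerKernel; positivity

theorem measurable_mehlerKernel (ρ : ℝ) :
    Measurable (fun p : ℝ × ℝ => mehlerKernel ρ p.1 p.2) := by
  unfold mehlerKernel; fun_prop

theorem mehlerKernel_zero (x y : ℝ) : mehlerKernel 0 x y = 1 := by
  simp [mehlerKernel]

theorem continuousAt_mehlerKernel (x y : ℝ) : ContinuousAt (fun ρ => mehlerKernel ρ x y) 0 := by
  unfold mehlerKernel
  refine ContinuousAt.mul (ContinuousAt.inv₀ (by fun_prop) (by simp)) ?_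
  refine Real.continuous_exp.continuousAt.comp (ContinuousAt.neg (ContinuousAt.div
    (by fun_prop) (by fun_prop) (by simp)))

theorem mehlerKernel_le {ρ : ℝ} (hρ : |ρ| ≤ 1 / 3) (x y : ℝ) :
    mehlerKernel ρ x y ≤ 2 * (Real.exp (x ^ 2 / 8) * Real.exp (y ^ 2 / 8)) := by
  have hρ2 : ρ ^ 2 ≤ 1 / 9 := by rw [← sq_abs]; nlinarith [abs_nonneg ρ]
  have hpos : 0 < 1 - ρ ^ 2 := by linarith
  unfold mehlerKernel
  gcongr
  · refine inv_le_of_inv_le₀ (by norm_num) ?_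
    exact Real.le_sqrt_of_sq_le (by norm_num; linarith)
  · rw [← Real.exp_add, Real.exp_le_exp, ← neg_div, div_le_iff₀ (by positivity)]
    have h1 : ρ * (x * y) ≤ |ρ| * ((x ^ 2 + y ^ 2) / 2) := by
      refine (le_abs_self _).trans ?_
      rw [abs_mul]
      refine mul_le_mul_of_nonneg_left ?_ (abs_nonneg ρ)
      rw [abs_le]
      constructor <;> nlinarith [sq_nonneg (x + y), sq_nonneg (x - y)]
    -- after division by `1 - |ρ|` the claim reads `4 |ρ| ≤ 1 + |ρ|`
    have h2 : |ρ| - ρ ^ 2 ≤ (1 - ρ ^ 2) / 4 := by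
      rw [← sq_abs]; nlinarith [abs_nonneg ρ]
    nlinarith [mul_le_mul_of_nonneg_right h2 (show 0 ≤ x ^ 2 + y ^ 2 by positivity)]

/-- The conditional law of the second component of a Gaussian pair, given that the first one
equals `x`. -/
theorem gaussianReal_map_conditional {ρ : ℝ} (hρ : ρ ^ 2 < 1) (x : ℝ) :
    (gaussianReal 0 1).map (fun z => ρ * x + √(1 - ρ ^ 2) * z)
      = (gaussianReal 0 1).withDensity (fun y => ENNReal.ofReal (mehlerKernel ρ x y)) := by
  have hpos : 0 < 1 - ρ ^ 2 := by linarith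
  have h1 : (gaussianReal 0 1).map (fun z => ρ * x + √(1 - ρ ^ 2) * z)
      = gaussianReal (ρ * x) (1 - ρ ^ 2).toNNReal := by
    rw [show (fun z => ρ * x + √(1 - ρ ^ 2) * z)
      = (fun z => ρ * x + z) ∘ (fun z => √(1 - ρ ^ 2) * z) from rfl,
      ← Measure.map_map (by fun_prop) (by fun_prop), gaussianReal_map_const_mul,
      gaussianReal_map_const_add]
    congr 1
    · ring
    · ext
      simp [Real.sq_sqrt hpos.le, hpos.le]
  have hmeas : Measurable (fun y => ENNReal.ofReal (mehlerKernel ρ x y)) :=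
    ((measurable_mehlerKernel ρ).comp (measurable_prodMk_left (x := x))).ennreal_ofReal
  rw [h1, gaussianReal_of_var_ne_zero _ (by simpa using hpos), gaussianReal_of_var_ne_zero _
    one_ne_zero, ← withDensity_mul _ (measurable_gaussianPDF 0 1) hmeas]
  congr 1
  ext y
  simp only [Pi.mul_apply, gaussianPDF]
  rw [← ENNReal.ofReal_mul (gaussianPDFReal_nonneg _ _ _)]
  congr 1
  simp only [gaussianPDFReal, mehlerKernel, Real.coe_toNNReal _ hpos.le, NNReal.coe_one, mul_one,
    sub_zero]
  rw [Real.sqrt_mul (by positivity), mul_inv, show ∀ a c d e : ℝ, a * c * (d * e) = a * d * (c * e)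
    from fun a c d e => by ring, ← Real.exp_add]
  congr 2
  field_simp
  ring

/-- Proved by writing `η = ρ ξ + √(1 - ρ²) Z` with `Z` standard Gaussian and independent of `ξ`. -/
theorem map_prodMk_eq_withDensity_mehlerKernel {Ω : Type*} [MeasurableSpace Ω] {P : Measure Ω}
    [IsProbabilityMeasure P] {ξ η : Ω → ℝ} (hG : HasGaussianLaw (fun ω => (ξ ω, η ω)) P)
    (hξ0 : P[ξ] = 0) (hη0 : P[η] = 0) (hξ1 : Var[ξ; P] = 1) (hη1 : Var[η; P] = 1)
    (hρ : cov[ξ, η; P] ^ 2 < 1) :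
    P.map (fun ω => (ξ ω, η ω)) = ((gaussianReal 0 1).prod (gaussianReal 0 1)).withDensity
      (fun p => ENNReal.ofReal (mehlerKernel cov[ξ, η; P] p.1 p.2)) := by
  set ρ := cov[ξ, η; P] with hρdef
  have hpos : 0 < 1 - ρ ^ 2 := by linarith
  set s := √(1 - ρ ^ 2) with hs
  have hs0 : s ≠ 0 := (Real.sqrt_pos.2 hpos).ne'
  have hs2 : s ^ 2 = 1 - ρ ^ 2 := Real.sq_sqrt hpos.le
  have hξm := hG.fst.memLp_two
  have hηm := hG.snd.memLp_two
  -- the innovation of `η` given `ξ`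
  set Z : Ω → ℝ := fun ω => s⁻¹ * (η ω - ρ * ξ ω) with hZ
  have hρξm : MemLp (fun ω => ρ * ξ ω) 2 P := hξm.const_mul ρ
  have hG' : HasGaussianLaw (fun ω => (ξ ω, Z ω)) P := by
    have := hG.map_fun ((ContinuousLinearMap.fst ℝ ℝ ℝ).prod
      (s⁻¹ • (ContinuousLinearMap.snd ℝ ℝ ℝ - ρ • ContinuousLinearMap.fst ℝ ℝ ℝ)))
    simpa [hZ] using this
  have hcov : cov[ξ, Z; P] = 0 := by
    rw [hZ, covariance_const_mul_right,
      show (fun ω => η ω - ρ * ξ ω) = η - fun ω => ρ * ξ ω from rfl,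
      covariance_sub_right hξm hηm hρξm, covariance_const_mul_right,
      covariance_self hξm.1.aemeasurable, hξ1]
    simp [hρdef]
  have hind := hG'.indepFun_of_covariance_eq_zero hcov
  have hZ0 : P[Z] = 0 := by
    simp only [hZ]
    rw [integral_const_mul, integral_sub (hηm.integrable one_le_two)
      (hρξm.integrable one_le_two), integral_const_mul, hξ0, hη0]
    simp
  have hZ1 : Var[Z; P] = 1 := by
    rw [hZ, variance_const_mul, show (fun ω => η ω - ρ * ξ ω) = η - fun ω => ρ * ξ ω from rfl,
      variance_sub hηm hρξm, variance_const_mul, covariance_const_mul_right, covariance_comm,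
      ← hρdef, hξ1, hη1]
    field_simp
    rw [hs2]; ring
  have hlawξ : P.map ξ = gaussianReal 0 1 := by
    rw [hG.fst.map_eq_gaussianReal, hξ0, hξ1, Real.toNNReal_one]
  have hlawZ : P.map Z = gaussianReal 0 1 := by
    rw [hG'.snd.map_eq_gaussianReal, hZ0, hZ1, Real.toNNReal_one]
  have hprod := (indepFun_iff_map_prod_eq_prod_map_map hG'.fst.aemeasurable
    hG'.snd.aemeasurable).1 hind
  rw [hlawξ, hlawZ] at hprod
  have hT : Measurable (fun p : ℝ × ℝ => (p.1, ρ * p.1 + s * p.2)) := by fun_prop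
  have hmap : P.map (fun ω => (ξ ω, η ω)) = ((gaussianReal 0 1).prod (gaussianReal 0 1)).map
      (fun p : ℝ × ℝ => (p.1, ρ * p.1 + s * p.2)) := by
    rw [← hprod, AEMeasurable.map_map_of_aemeasurable hT.aemeasurable hG'.aemeasurable]
    congr 1
    ext ω
    · rfl
    · simp only [Function.comp, hZ]
      field_simp
      ring
  have hk : Measurable (fun p : ℝ × ℝ => ENNReal.ofReal (mehlerKernel ρ p.1 p.2)) :=
    (measurable_mehlerKernel ρ).ennreal_ofReal
  rw [hmap]
  ext A hA
  rw [Measure.map_apply hT hA, Measure.prod_apply (hT hA), withDensity_apply _ hA,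
    ← lintegral_indicator hA, lintegral_prod _ (hk.indicator hA).aemeasurable]
  refine lintegral_congr fun x => ?_
  have hAx : MeasurableSet (Prod.mk x ⁻¹' A) := measurable_prodMk_left hA
  have h := congrArg (fun m : Measure ℝ => m (Prod.mk x ⁻¹' A))
    (gaussianReal_map_conditional hρ x)
  beta_reduce at h
  rw [Measure.map_apply (by fun_prop) hAx, withDensity_apply _ hAx,
    ← lintegral_indicator hAx] at h
  exact h

theorem integral_mul_eq_integral_mehlerKernel {Ω : Type*} [MeasurableSpace Ω] {P : Measure Ω}
    [IsProbabilityMeasure P] {ξ η : Ω → ℝ} (hG : HasGaussianLaw (fun ω => (ξ ω, η ω)) P)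
    (hξ0 : P[ξ] = 0) (hη0 : P[η] = 0) (hξ1 : Var[ξ; P] = 1) (hη1 : Var[η; P] = 1)
    (hρ : cov[ξ, η; P] ^ 2 < 1) {f g : ℝ → ℝ} (hf : Measurable f) (hg : Measurable g) :
    ∫ ω, f (ξ ω) * g (η ω) ∂P = ∫ p, mehlerKernel cov[ξ, η; P] p.1 p.2 * (f p.1 * g p.2)
      ∂(gaussianReal 0 1).prod (gaussianReal 0 1) := by
  have h : ∫ ω, f (ξ ω) * g (η ω) ∂P = ∫ p, f p.1 * g p.2 ∂(P.map fun ω => (ξ ω, η ω)) :=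
    (integral_map hG.aemeasurable
      (f := fun p : ℝ × ℝ => f p.1 * g p.2) (by fun_prop)).symm
  rw [h, map_prodMk_eq_withDensity_mehlerKernel hG hξ0 hη0 hξ1 hη1 hρ,
    integral_withDensity_eq_integral_toReal_smul (measurable_mehlerKernel _).ennreal_ofReal
      (Eventually.of_forall fun _ => ENNReal.ofReal_lt_top)]
  simp only [ENNReal.toReal_ofReal (mehlerKernel_nonneg _ _ _), smul_eq_mul]

/-- As the correlation tends to zero, the components of a Gaussian pair decouple, under a growth
condition that is weaker than square integrability. -/
theorem tendsto_integral_mehlerKernel_mul {ι : Type*} {l : Filter ι} [l.IsCountablyGenerated]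
    {ρ : ι → ℝ} {f : ι → ℝ → ℝ} {g F : ℝ → ℝ} (hρ : Tendsto ρ l (𝓝 0))
    (hf : ∀ i, Measurable (f i)) (hfF : ∀ i x, |f i x| ≤ F x)
    (hF : Integrable (fun x => F x * Real.exp (x ^ 2 / 8)) (gaussianReal 0 1))
    (hfg : ∀ x, Tendsto (fun i => f i x) l (𝓝 (g x))) :
    Tendsto (fun i => ∫ p, mehlerKernel (ρ i) p.1 p.2 * (f i p.1 * f i p.2)
      ∂(gaussianReal 0 1).prod (gaussianReal 0 1)) l (𝓝 ((∫ x, g x ∂gaussianReal 0 1) ^ 2)) := by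
  have hlim : (∫ x, g x ∂gaussianReal 0 1) ^ 2
      = ∫ p : ℝ × ℝ, g p.1 * g p.2 ∂(gaussianReal 0 1).prod (gaussianReal 0 1) := by
    rw [integral_prod_mul, sq]
  rw [hlim]
  refine tendsto_integral_filter_of_dominated_convergence
    (fun p : ℝ × ℝ => 2 * ((F p.1 * Real.exp (p.1 ^ 2 / 8)) * (F p.2 * Real.exp (p.2 ^ 2 / 8))))
    (Eventually.of_forall fun i => ?_) ?_ ((hF.mul_prod hF).const_mul 2)
    (Eventually.of_forall fun p => ?_)
  · have := hf i
    exact ((measurable_mehlerKernel _).mul (by fun_prop)).aestronglyMeasurable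
  · have h3 : ∀ᶠ i in l, |ρ i| ≤ 1 / 3 := by
      have := hρ.abs
      rw [abs_zero] at this
      exact this.eventually (ge_mem_nhds (by norm_num))
    filter_upwards [h3] with i hi
    refine Eventually.of_forall fun p => ?_
    rw [norm_mul, norm_mul, Real.norm_eq_abs, Real.norm_eq_abs, Real.norm_eq_abs,
      abs_of_nonneg (mehlerKernel_nonneg _ _ _)]
    calc _ ≤ (2 * (Real.exp (p.1 ^ 2 / 8) * Real.exp (p.2 ^ 2 / 8))) * (F p.1 * F p.2) := by
          have h0 : 0 ≤ F p.1 := (abs_nonneg _).trans (hfF i p.1)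
          gcongr
          · exact mehlerKernel_le hi _ _
          · exact hfF i p.1
          · exact hfF i p.2
      _ = _ := by ring
  · have hk : Tendsto (fun i => mehlerKernel (ρ i) p.1 p.2) l (𝓝 1) := by
      have := (continuousAt_mehlerKernel p.1 p.2).tendsto.comp hρ
      rwa [mehlerKernel_zero] at this
    simpa using hk.mul ((hfg p.1).mul (hfg p.2))

theorem memLp_one_add_abs_mul_exp :
    MemLp (fun x : ℝ => (1 + |x|) * Real.exp (x ^ 2 / 8)) 2 (gaussianReal 0 1) := by
  have hmeas : Measurable (fun x : ℝ => (1 + |x|) * Real.exp (x ^ 2 / 8)) := by fun_prop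
  rw [memLp_two_iff_integrable_sq hmeas.aestronglyMeasurable]
  have hint : Integrable (fun x : ℝ => Real.exp 8 * Real.exp (3 * x ^ 2 / 8))
      (gaussianReal 0 1) := by
    refine Integrable.const_mul ?_ _
    rw [gaussianReal_of_var_ne_zero _ one_ne_zero, integrable_withDensity_iff
      (measurable_gaussianPDF 0 1) (Eventually.of_forall fun x => gaussianPDF_lt_top)]
    have h := (integrable_exp_neg_mul_sq (b := 1 / 8) (by norm_num)).const_mul (√(2 * Real.pi))⁻¹
    refine h.congr (Eventually.of_forall fun x => ?_)
    simp only [toReal_gaussianPDF, gaussianPDFReal, NNReal.coe_one, mul_one, sub_zero]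
    rw [mul_comm (Real.exp (3 * x ^ 2 / 8)), mul_assoc, ← Real.exp_add]
    congr 2
    ring
  refine hint.mono' (hmeas.pow_const 2).aestronglyMeasurable (Eventually.of_forall fun x => ?_)
  rw [Real.norm_of_nonneg (sq_nonneg _)]
  -- `1 + |x| ≤ e^{|x|} ≤ e^{x² / 16 + 4}`
  have h1 : 1 + |x| ≤ Real.exp (x ^ 2 / 16 + 4) := by
    refine (add_comm _ _).trans_le ((Real.add_one_le_exp |x|).trans ?_)
    rw [Real.exp_le_exp, ← sq_abs x]
    nlinarith [sq_nonneg (|x| - 8)]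
  calc ((1 + |x|) * Real.exp (x ^ 2 / 8)) ^ 2
      ≤ (Real.exp (x ^ 2 / 16 + 4) * Real.exp (x ^ 2 / 8)) ^ 2 := by gcongr
    _ = Real.exp 8 * Real.exp (3 * x ^ 2 / 8) := by
      rw [← Real.exp_add, ← Real.exp_add, ← Real.exp_nat_mul]
      congr 1
      push_cast; ring

theorem integrable_one_add_abs_mul_mul_exp {g : ℝ → ℝ} (hg : MemLp g 2 (gaussianReal 0 1)) :
    Integrable (fun x => (1 + |x|) * g x * Real.exp (x ^ 2 / 8)) (gaussianReal 0 1) := by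
  refine (memLp_one_add_abs_mul_exp.integrable_mul hg).congr (Eventually.of_forall fun x => ?_)
  simp only [Pi.mul_apply]
  ring

/-! ### Convergence in probability and negligible double sums -/

theorem tendstoInMeasure_zero_of_tendsto_integral_sq {Ω : Type*} [MeasurableSpace Ω]
    {P : Measure Ω} [IsFiniteMeasure P] {W : ℕ → Ω → ℝ} (hW : ∀ n, MemLp (W n) 2 P)
    (h : Tendsto (fun n => ∫ ω, W n ω ^ 2 ∂P) atTop (𝓝 0)) :
    TendstoInMeasure P W atTop (fun _ => 0) := by
  rw [tendstoInMeasure_iff_measureReal_norm]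
  intro r hr
  have h' : Tendsto (fun n => (∫ ω, W n ω ^ 2 ∂P) / r ^ 2) atTop (𝓝 0) := by
    simpa using h.div_const (r ^ 2)
  refine squeeze_zero (fun _ => measureReal_nonneg) (fun n => ?_) h'
  rw [le_div_iff₀ (by positivity), mul_comm]
  refine le_trans ?_ (mul_meas_ge_le_integral_of_nonneg
    (Eventually.of_forall fun ω => sq_nonneg (W n ω)) (hW n).integrable_sq (r ^ 2))
  refine mul_le_mul_of_nonneg_left (measureReal_mono fun ω hω => ?_) (by positivity)
  simp only [sub_zero, Real.norm_eq_abs, Set.mem_ofPred_eq] at hω ⊢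
  rw [← sq_abs (W n ω)]
  gcongr

theorem tendstoInMeasure_of_tendsto_measureReal_ne {Ω E : Type*} [MeasurableSpace Ω]
    {P : Measure Ω} [IsFiniteMeasure P] [SeminormedAddCommGroup E] {f g : ℕ → Ω → E} {h : Ω → E}
    (hfg : Tendsto (fun n => P.real {ω | f n ω ≠ g n ω}) atTop (𝓝 0))
    (hg : TendstoInMeasure P g atTop h) : TendstoInMeasure P f atTop h := by
  rw [tendstoInMeasure_iff_measureReal_norm] at hg ⊢
  intro r hr
  have h0 := hfg.add (hg r hr)
  rw [add_zero] at h0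
  refine squeeze_zero (fun _ => measureReal_nonneg) (fun n => ?_) h0
  refine le_trans (measureReal_mono fun ω hω => ?_) (measureReal_union_le _ _)
  by_cases hne : f n ω = g n ω
  · right
    simp only [Set.mem_ofPred_eq] at hω ⊢
    rwa [← hne]
  · exact Or.inl hne

theorem sum_sum_natAbs_lt_le (n K : ℕ) :
    ∑ s ∈ Finset.Icc (1 : ℤ) n, ∑ t ∈ Finset.Icc (1 : ℤ) n,
      (if (s - t).natAbs < K then (1 : ℝ) else 0) ≤ n * (2 * K + 1) := by
  have h : ∀ s : ℤ, ∑ t ∈ Finset.Icc (1 : ℤ) n, (if (s - t).natAbs < K then (1 : ℝ) else 0)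
      ≤ 2 * K + 1 := by
    intro s
    rw [Finset.sum_boole]
    have hc : (Finset.filter (fun t : ℤ => (s - t).natAbs < K) (Finset.Icc (1 : ℤ) n)).card
        ≤ (Finset.Icc (s - K) (s + K)).card := by
      refine Finset.card_le_card fun t ht => ?_
      simp only [Finset.mem_filter, Finset.mem_Icc] at ht ⊢
      omega
    rw [Int.card_Icc] at hc
    exact_mod_cast hc.trans (by omega)
  calc _ ≤ ∑ s ∈ Finset.Icc (1 : ℤ) n, (2 * (K : ℝ) + 1) := Finset.sum_le_sum fun s _ => h s
    _ = n * (2 * K + 1) := by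
      rw [Finset.sum_const, Int.card_Icc, nsmul_eq_mul]; simp

/-- Double sums whose coefficients vanish far from the diagonal are negligible. The diagonal band
is controlled by the bound `B n` on all coefficients. -/
theorem tendsto_sum_sum_mul_zero {a : ℕ → ℕ → ℝ} {B γ : ℕ → ℝ} {H M c : ℝ}
    (haB : ∀ n k, |a n k| ≤ B n) (hγ : ∀ k, |γ k| ≤ c)
    (hB : Tendsto (fun n : ℕ => (n : ℝ) ^ (1 - 2 * H) * B n) atTop (𝓝 0))
    (ha : Tendsto (fun q : ℕ × ℕ => a q.1 q.2) (atTop ×ˢ atTop) (𝓝 0))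
    (hM : ∀ᶠ n : ℕ in atTop, (n : ℝ) ^ (-(2 * H)) * ∑ s ∈ Finset.Icc (1 : ℤ) n,
      ∑ t ∈ Finset.Icc (1 : ℤ) n, |γ (s - t).natAbs| ≤ M) :
    Tendsto (fun n : ℕ => (n : ℝ) ^ (-(2 * H)) * ∑ s ∈ Finset.Icc (1 : ℤ) n,
      ∑ t ∈ Finset.Icc (1 : ℤ) n, a n (s - t).natAbs * γ (s - t).natAbs) atTop (𝓝 0) := by
  rw [Metric.tendsto_nhds]
  intro η hη
  have hc : 0 ≤ c := (abs_nonneg _).trans (hγ 0)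
  have hκ : 0 < η / (2 * (|M| + 1)) := by positivity
  set κ := η / (2 * (|M| + 1)) with hκdef
  rw [prod_atTop_atTop_eq] at ha
  obtain ⟨⟨N, K⟩, hNK⟩ := eventually_atTop.1 (Metric.tendsto_nhds.1 ha κ hκ)
  have hB' : Tendsto (fun n : ℕ => c * (2 * K + 1) * ((n : ℝ) ^ (1 - 2 * H) * B n)) atTop (𝓝 0) :=
    by simpa using hB.const_mul (c * (2 * K + 1))
  filter_upwards [hM, eventually_ge_atTop N, eventually_gt_atTop 0,
    hB'.eventually (gt_mem_nhds (half_pos hη))] with n hMn hnN hn0 hBn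
  have hn : (0 : ℝ) < n := by exact_mod_cast hn0
  have hB0 : 0 ≤ B n := (abs_nonneg _).trans (haB n 0)
  have hterm : ∀ k, |a n k * γ k| ≤ κ * |γ k| + B n * c * (if k < K then 1 else 0) := by
    intro k
    rw [abs_mul]
    split_ifs with hk
    · have : |a n k| * |γ k| ≤ B n * c := by gcongr; exacts [haB n k, hγ k]
      have h2 : 0 ≤ κ * |γ k| := by positivity
      linarith
    · have h := hNK (n, k) ⟨hnN, not_lt.1 hk⟩
      rw [Real.dist_0_eq_abs] at h
      rw [mul_zero, add_zero]
      exact mul_le_mul_of_nonneg_right h.le (abs_nonneg _)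
  have hsum : |∑ s ∈ Finset.Icc (1 : ℤ) n, ∑ t ∈ Finset.Icc (1 : ℤ) n,
      a n (s - t).natAbs * γ (s - t).natAbs|
      ≤ κ * ∑ s ∈ Finset.Icc (1 : ℤ) n, ∑ t ∈ Finset.Icc (1 : ℤ) n, |γ (s - t).natAbs|
        + B n * c * (n * (2 * K + 1)) := by
    refine (Finset.abs_sum_le_sum_abs _ _).trans ?_
    refine (Finset.sum_le_sum fun s _ => (Finset.abs_sum_le_sum_abs _ _).trans
      (Finset.sum_le_sum fun t _ => hterm (s - t).natAbs)).trans ?_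
    simp_rw [Finset.sum_add_distrib, ← Finset.mul_sum]
    gcongr
    exact sum_sum_natAbs_lt_le n K
  have hpw : (n : ℝ) ^ (1 - 2 * H) = (n : ℝ) ^ (-(2 * H)) * n := by
    rw [show 1 - 2 * H = -(2 * H) + 1 by ring, Real.rpow_add hn, Real.rpow_one]
  rw [Real.dist_0_eq_abs, abs_mul, abs_of_pos (Real.rpow_pos_of_pos hn _)]
  calc _ ≤ (n : ℝ) ^ (-(2 * H)) * (κ * ∑ s ∈ Finset.Icc (1 : ℤ) n,
          ∑ t ∈ Finset.Icc (1 : ℤ) n, |γ (s - t).natAbs| + B n * c * (n * (2 * K + 1))) := by gcongr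
    _ = κ * ((n : ℝ) ^ (-(2 * H)) * ∑ s ∈ Finset.Icc (1 : ℤ) n,
          ∑ t ∈ Finset.Icc (1 : ℤ) n, |γ (s - t).natAbs|)
          + c * (2 * K + 1) * ((n : ℝ) ^ (1 - 2 * H) * B n) := by rw [hpw]; ring
    _ < κ * (|M| + 1) + η / 2 := by
        refine add_lt_add_of_le_of_lt (mul_le_mul_of_nonneg_left ?_ hκ.le) hBn
        linarith [le_abs_self M]
    _ = η := by rw [hκdef]; field_simp; ring

/-! ### Sums of nonlinear functionals of the Gaussian process against the errors -/

/-- A strictly stationary process with standard normal marginals whose correlations tend to zero.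
Only pairs of its values are required to be jointly Gaussian. -/
structure IsMixingStdGaussian {Ω : Type*} [MeasurableSpace Ω] (ξ : ℤ → Ω → ℝ) (P : Measure Ω) :
    Prop where
  measurable : ∀ t, Measurable (ξ t)
  gaussian : ∀ s t, HasGaussianLaw (fun ω => (ξ s ω, ξ t ω)) P
  stationary : IsStrictlyStationary ξ P
  mean_zero : P[ξ 0] = 0
  variance_one : Var[ξ 0; P] = 1
  tendsto_autoCov : Tendsto (autoCov ξ P) atTop (𝓝 0)

theorem IsStrictlyStationary.identDistrib_prodMk {Ω : Type*} [MeasurableSpace Ω] {P : Measure Ω}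
    {X : ℤ → Ω → ℝ} (hX : IsStrictlyStationary X P) (s t k : ℤ) :
    IdentDistrib (fun ω => (X (s + k) ω, X (t + k) ω)) (fun ω => (X s ω, X t ω)) P P :=
  (hX k).comp (u := fun e : ℤ → ℝ => (e s, e t)) (by fun_prop)

theorem IsStrictlyStationary.identDistrib {Ω : Type*} [MeasurableSpace Ω] {P : Measure Ω}
    {X : ℤ → Ω → ℝ} (hX : IsStrictlyStationary X P) (t : ℤ) :
    IdentDistrib (X t) (X 0) P P := by
  have := (hX t).comp (u := fun e : ℤ → ℝ => e 0) (by fun_prop)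
  simpa [Function.comp_def] using this

theorem IsStrictlyStationary.integral_mul {Ω : Type*} [MeasurableSpace Ω] {P : Measure Ω}
    {X : ℤ → Ω → ℝ} (hX : IsStrictlyStationary X P) {f : ℝ → ℝ} (hf : Measurable f) (s t : ℤ) :
    ∫ ω, f (X s ω) * f (X t ω) ∂P = ∫ ω, f (X 0 ω) * f (X ((s - t).natAbs : ℤ) ω) ∂P := by
  have key : ∀ (s : ℤ) (k : ℕ), ∫ ω, f (X s ω) * f (X (s + k) ω) ∂P
      = ∫ ω, f (X 0 ω) * f (X (k : ℤ) ω) ∂P := by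
    intro s k
    have h := ((hX.identDistrib_prodMk 0 k s).comp
      (u := fun p : ℝ × ℝ => f p.1 * f p.2) (by fun_prop)).integral_eq
    simpa [Function.comp_def, add_comm] using h
  rcases le_total s t with h | h
  · rw [← key s]
    have : s + ((s - t).natAbs : ℤ) = t := by omega
    rw [this]
  · rw [← key t]
    have : t + ((s - t).natAbs : ℤ) = s := by omega
    rw [this]
    simp_rw [mul_comm]

namespace IsMixingStdGaussian

variable {Ω : Type*} [MeasurableSpace Ω] {P : Measure Ω} {ξ : ℤ → Ω → ℝ}

theorem map_eq (hξ : IsMixingStdGaussian ξ P) (t : ℤ) : P.map (ξ t) = gaussianReal 0 1 := by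
  rw [(hξ.stationary.identDistrib t).map_eq, (hξ.gaussian 0 0).fst.map_eq_gaussianReal,
    hξ.mean_zero, hξ.variance_one, Real.toNNReal_one]

theorem memLp_comp (hξ : IsMixingStdGaussian ξ P) {f : ℝ → ℝ} (hf : MemLp f 2 (gaussianReal 0 1))
    (t : ℤ) : MemLp (fun ω => f (ξ t ω)) 2 P := by
  have hmap := hξ.map_eq t
  exact MemLp.comp_of_map (hmap ▸ hf) (hξ.measurable t).aemeasurable

theorem integral_comp (hξ : IsMixingStdGaussian ξ P) {f : ℝ → ℝ} (hf : Measurable f) (t : ℤ) :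
    ∫ ω, f (ξ t ω) ∂P = ∫ x, f x ∂gaussianReal 0 1 := by
  rw [← hξ.map_eq t, integral_map (hξ.measurable t).aemeasurable hf.aestronglyMeasurable]

/-- The maximum of `n` standard Gaussian variables is `o(n^δ)` in probability. -/
theorem tendsto_measureReal_exists_gt (hξ : IsMixingStdGaussian ξ P) {δ : ℝ} (hδ : 0 < δ) :
    Tendsto (fun n : ℕ => P.real {ω | ∃ t ∈ Finset.Icc (1 : ℤ) n, (n : ℝ) ^ δ < |ξ t ω|}) atTop
      (𝓝 0) := by
  have : IsProbabilityMeasure P := (hξ.gaussian 0 0).isProbabilityMeasure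
  obtain ⟨p, hp⟩ := exists_nat_gt (2 / δ)
  have hp2 : 2 < δ * p := by rw [div_lt_iff₀ hδ] at hp; linarith
  set m := ∫ x : ℝ, |x| ^ p ∂gaussianReal 0 1 with hm
  have hint : ∀ t, Integrable (fun ω => |ξ t ω| ^ p) P := by
    intro t
    have h : Integrable (fun x : ℝ => |x| ^ p) (P.map (ξ t)) := by
      rw [hξ.map_eq t]
      have := (memLp_id_gaussianReal (μ := 0) (v := 1) p).integrable_norm_pow' (p := p)
      simpa using this
    exact h.comp_aemeasurable (hξ.measurable t).aemeasurable
  have hlim : Tendsto (fun n : ℕ => m * (n : ℝ) ^ (-(1 : ℝ))) atTop (𝓝 0) := by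
    simpa using ((tendsto_rpow_neg_atTop one_pos).comp
      (tendsto_natCast_atTop_atTop (R := ℝ))).const_mul m
  refine squeeze_zero' (Eventually.of_forall fun _ => measureReal_nonneg) ?_ hlim
  filter_upwards [eventually_ge_atTop 1] with n hn
  have hn1 : (1 : ℝ) ≤ n := by exact_mod_cast hn
  have hn0 : (0 : ℝ) < n := by linarith
  have htail : ∀ t, P.real {ω | (n : ℝ) ^ δ < |ξ t ω|} ≤ m * (n : ℝ) ^ (-(2 : ℝ)) := by
    intro t
    have h1 := mul_meas_ge_le_integral_of_nonneg
      (Eventually.of_forall fun ω => by positivity) (hint t) ((n : ℝ) ^ (2 : ℝ))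
    rw [hξ.integral_comp (f := fun x => |x| ^ p) (by fun_prop) t, ← hm] at h1
    rw [Real.rpow_neg hn0.le, ← div_eq_mul_inv, le_div_iff₀ (by positivity), mul_comm]
    refine le_trans (mul_le_mul_of_nonneg_left (measureReal_mono fun ω hω => ?_)
      (by positivity)) h1
    simp only [Set.mem_ofPred_eq] at hω ⊢
    calc (n : ℝ) ^ (2 : ℝ) ≤ (n : ℝ) ^ (δ * p) := Real.rpow_le_rpow_of_exponent_le hn1 hp2.le
      _ = ((n : ℝ) ^ δ) ^ p := by rw [Real.rpow_mul hn0.le, Real.rpow_natCast]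
      _ ≤ |ξ t ω| ^ p := by gcongr
  have hU : {ω | ∃ t ∈ Finset.Icc (1 : ℤ) n, (n : ℝ) ^ δ < |ξ t ω|}
      = ⋃ t ∈ Finset.Icc (1 : ℤ) n, {ω | (n : ℝ) ^ δ < |ξ t ω|} := by
    ext ω; simp
  rw [hU]
  refine (measureReal_biUnion_finset_le _ _).trans ((Finset.sum_le_sum fun t _ => htail t).trans ?_)
  rw [Finset.sum_const, Int.card_Icc, nsmul_eq_mul]
  have e : (((n : ℤ) + 1 - 1).toNat : ℝ) = n := by simp
  have e2 : (n : ℝ) * (n : ℝ) ^ (-(2 : ℝ)) = (n : ℝ) ^ (-(1 : ℝ)) := by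
    nth_rewrite 1 [← Real.rpow_one (n : ℝ)]
    rw [← Real.rpow_add hn0]; norm_num
  rw [e, ← e2]
  exact le_of_eq (by ring)

/-- A centred function `f` of the Gaussian process, weighted by errors `u` that are independent of
it, has partial sums of smaller order than `n^H`, the order of magnitude of the partial sums of `u`.
The function `f` need not be square integrable: the values of `ξ` beyond `n^δ` are discarded, with
probability tending to one nothing is lost, and the truncated sums converge to zero in mean
square. -/
theorem tendstoInMeasure_sum_mul (hξ : IsMixingStdGaussian ξ P) {u : ℤ → Ω → ℝ}
    (hu : ∀ t, MemLp (u t) 2 P)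
    (hind : ∀ s t, IndepFun (fun ω => (u s ω, u t ω)) (fun ω => (ξ s ω, ξ t ω)) P)
    {γ : ℕ → ℝ} (hγ : ∀ s t, ∫ ω, u s ω * u t ω ∂P = γ (s - t).natAbs) {c M H : ℝ}
    (hγc : ∀ k, |γ k| ≤ c) (hH : 1 / 2 < H)
    (hM : ∀ᶠ n : ℕ in atTop, (n : ℝ) ^ (-(2 * H)) * ∑ s ∈ Finset.Icc (1 : ℤ) n,
      ∑ t ∈ Finset.Icc (1 : ℤ) n, |γ (s - t).natAbs| ≤ M)
    {f g : ℝ → ℝ} (hf : Measurable f) (hfg : ∀ x, |f x| ≤ (1 + |x|) * g x)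
    (hg : MemLp g 2 (gaussianReal 0 1)) (hf0 : ∫ x, f x ∂gaussianReal 0 1 = 0) :
    TendstoInMeasure P (fun (n : ℕ) ω => (n : ℝ) ^ (-H) * ∑ t ∈ Finset.Icc (1 : ℤ) n,
      f (ξ t ω) * u t ω) atTop (fun _ => 0) := by
  have : IsProbabilityMeasure P := (hξ.gaussian 0 0).isProbabilityMeasure
  have hg0 : ∀ x, 0 ≤ g x := fun x =>
    nonneg_of_mul_nonneg_right ((abs_nonneg _).trans (hfg x)) (by positivity)
  set δ := (2 * H - 1) / 4 with hδdef
  have hδ : 0 < δ := by rw [hδdef]; linarith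
  -- the truncated functions
  set F : ℕ → ℝ → ℝ := fun n x => if |x| ≤ (n : ℝ) ^ δ then f x else 0 with hF
  have hFm : ∀ n, Measurable (F n) := fun n =>
    Measurable.ite (measurableSet_le (by fun_prop) measurable_const) hf measurable_const
  have hFf : ∀ n x, |F n x| ≤ (1 + |x|) * g x := by
    intro n x
    simp only [hF]
    split_ifs
    · exact hfg x
    · rw [abs_zero]; exact mul_nonneg (by positivity) (hg0 x)
  have hFg : ∀ n x, |F n x| ≤ (1 + (n : ℝ) ^ δ) * g x := by
    intro n x
    simp only [hF]
    split_ifs with h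
    · exact (hfg x).trans (mul_le_mul_of_nonneg_right (by linarith) (hg0 x))
    · rw [abs_zero]; exact mul_nonneg (by positivity) (hg0 x)
  have hFL : ∀ n, MemLp (F n) 2 (gaussianReal 0 1) := fun n =>
    (hg.const_mul (1 + (n : ℝ) ^ δ)).mono' (hFm n).aestronglyMeasurable
      (Eventually.of_forall fun x => hFg n x)
  have hFξ : ∀ n t, MemLp (fun ω => F n (ξ t ω)) 2 P := fun n t => hξ.memLp_comp (hFL n) t
  have hFt : ∀ x, Tendsto (fun n => F n x) atTop (𝓝 (f x)) := by
    intro x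
    refine tendsto_const_nhds.congr' ?_
    have := ((tendsto_rpow_atTop hδ).comp
      (tendsto_natCast_atTop_atTop (R := ℝ))).eventually_ge_atTop |x|
    filter_upwards [this] with n hn
    exact (if_pos hn).symm
  set a : ℕ → ℕ → ℝ := fun n k => ∫ ω, F n (ξ 0 ω) * F n (ξ (k : ℤ) ω) ∂P with ha
  set B : ℕ → ℝ := fun n => ∫ x, F n x ^ 2 ∂gaussianReal 0 1 with hB
  have hsq : ∀ n t, ∫ ω, F n (ξ t ω) ^ 2 ∂P = B n := fun n t =>
    hξ.integral_comp (f := fun x => F n x ^ 2) ((hFm n).pow_const 2) t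
  have haB : ∀ n k, |a n k| ≤ B n := by
    intro n k
    have h1 := (hFξ n 0).integrable_sq
    have h2 := (hFξ n k).integrable_sq
    calc |a n k| ≤ ∫ ω, |F n (ξ 0 ω) * F n (ξ (k : ℤ) ω)| ∂P := abs_integral_le_integral_abs
      _ ≤ ∫ ω, (F n (ξ 0 ω) ^ 2 + F n (ξ (k : ℤ) ω) ^ 2) / 2 ∂P := by
          refine integral_mono ((hFξ n 0).integrable_mul (hFξ n k)).abs ((h1.add h2).div_const 2)
            fun ω => ?_
          simp only [abs_mul]
          rw [← sq_abs (F n (ξ 0 ω)), ← sq_abs (F n (ξ (k : ℤ) ω))]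
          nlinarith [sq_nonneg (|F n (ξ 0 ω)| - |F n (ξ (k : ℤ) ω)|)]
      _ = B n := by
          rw [integral_div, integral_add h1 h2, hsq, hsq]; ring
  have hBlim : Tendsto (fun n : ℕ => (n : ℝ) ^ (1 - 2 * H) * B n) atTop (𝓝 0) := by
    set G := ∫ x, g x ^ 2 ∂gaussianReal 0 1 with hG
    have hup : Tendsto (fun n : ℕ => 4 * G * (n : ℝ) ^ (-((2 * H - 1) / 2))) atTop (𝓝 0) := by
      simpa using ((tendsto_rpow_neg_atTop (by linarith : 0 < (2 * H - 1) / 2)).comp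
        (tendsto_natCast_atTop_atTop (R := ℝ))).const_mul (4 * G)
    have hB0 : ∀ n, 0 ≤ B n := fun n => integral_nonneg fun x => sq_nonneg _
    refine squeeze_zero' (Eventually.of_forall fun n => mul_nonneg (by positivity) (hB0 n)) ?_ hup
    filter_upwards [eventually_ge_atTop 1] with n hn
    have hn1 : (1 : ℝ) ≤ n := by exact_mod_cast hn
    have hn0 : (0 : ℝ) < n := by linarith
    have hG0 : 0 ≤ G := integral_nonneg fun x => sq_nonneg _
    have hBn : B n ≤ (1 + (n : ℝ) ^ δ) ^ 2 * G := by
      rw [hG, ← integral_const_mul]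
      refine integral_mono (hFL n).integrable_sq (hg.integrable_sq.const_mul _) fun x => ?_
      simp only
      rw [← mul_pow, ← sq_abs (F n x)]
      exact pow_le_pow_left₀ (abs_nonneg _) (hFg n x) 2
    have h1 : 1 ≤ (n : ℝ) ^ δ := Real.one_le_rpow hn1 hδ.le
    have e : (n : ℝ) ^ (1 - 2 * H) * ((n : ℝ) ^ δ) ^ 2 = (n : ℝ) ^ (-((2 * H - 1) / 2)) := by
      rw [← Real.rpow_natCast, ← Real.rpow_mul hn0.le, ← Real.rpow_add hn0, hδdef]
      congr 1; push_cast; ring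
    calc (n : ℝ) ^ (1 - 2 * H) * B n
        ≤ (n : ℝ) ^ (1 - 2 * H) * ((2 * (n : ℝ) ^ δ) ^ 2 * G) := by
          gcongr
          refine hBn.trans ?_
          gcongr
          linarith
      _ = 4 * G * ((n : ℝ) ^ (1 - 2 * H) * ((n : ℝ) ^ δ) ^ 2) := by ring
      _ = _ := by rw [e]
  have halim : Tendsto (fun q : ℕ × ℕ => a q.1 q.2) (atTop ×ˢ atTop) (𝓝 0) := by
    have hρ : Tendsto (fun q : ℕ × ℕ => autoCov ξ P q.2) (atTop ×ˢ atTop) (𝓝 0) :=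
      hξ.tendsto_autoCov.comp tendsto_snd
    have h := tendsto_integral_mehlerKernel_mul (f := fun q : ℕ × ℕ => F q.1) (g := f) hρ
      (fun q => hFm q.1) (fun q => hFf q.1) (integrable_one_add_abs_mul_mul_exp hg)
      (fun x => (hFt x).comp tendsto_fst)
    rw [hf0, zero_pow two_ne_zero] at h
    refine h.congr' ?_
    have h1 : ∀ᶠ q : ℕ × ℕ in atTop ×ˢ atTop, autoCov ξ P q.2 ^ 2 < 1 := by
      have := hρ.pow 2
      rw [zero_pow two_ne_zero] at this
      exact this.eventually (gt_mem_nhds one_pos)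
    filter_upwards [h1] with q hq
    have hid := hξ.stationary.identDistrib (q.2 : ℤ)
    exact (integral_mul_eq_integral_mehlerKernel (hξ.gaussian _ _) hξ.mean_zero
      (hid.integral_eq.trans hξ.mean_zero) hξ.variance_one (hid.variance_eq.trans hξ.variance_one)
      hq (hFm q.1) (hFm q.1)).symm
  -- the truncated sums converge in mean square
  set W : ℕ → Ω → ℝ := fun n ω => (n : ℝ) ^ (-H) * ∑ t ∈ Finset.Icc (1 : ℤ) n,
    F n (ξ t ω) * u t ω with hW
  have hFF : ∀ n, Measurable (fun p : ℝ × ℝ => F n p.1 * F n p.2) := fun n =>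
    ((hFm n).comp measurable_fst).mul ((hFm n).comp measurable_snd)
  have hind1 : ∀ n s t, IndepFun (fun ω => F n (ξ s ω) * F n (ξ t ω)) (fun ω => u s ω * u t ω) P :=
    fun n s t => ((hind s t).comp (φ := fun p : ℝ × ℝ => p.1 * p.2) (by fun_prop) (hFF n)).symm
  have hint : ∀ n s t, Integrable (fun ω => (F n (ξ s ω) * F n (ξ t ω)) * (u s ω * u t ω)) P :=
    fun n s t => (hind1 n s t).integrable_mul ((hFξ n s).integrable_mul (hFξ n t))
      ((hu s).integrable_mul (hu t))
  have hFu : ∀ n t, MemLp (fun ω => F n (ξ t ω) * u t ω) 2 P := by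
    intro n t
    have hm : AEStronglyMeasurable (fun ω => F n (ξ t ω) * u t ω) P := (hFξ n t).1.mul (hu t).1
    rw [memLp_two_iff_integrable_sq hm]
    exact (hint n t t).congr (Eventually.of_forall fun ω => by ring)
  have hWm : ∀ n, MemLp (W n) 2 P := fun n =>
    (memLp_finsetSum _ fun t _ => hFu n t).const_mul _
  have hWsq : ∀ n : ℕ, ∫ ω, W n ω ^ 2 ∂P = (n : ℝ) ^ (-(2 * H)) * ∑ s ∈ Finset.Icc (1 : ℤ) n,
      ∑ t ∈ Finset.Icc (1 : ℤ) n, a n (s - t).natAbs * γ (s - t).natAbs := by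
    intro n
    have e : ∀ ω, W n ω ^ 2 = ((n : ℝ) ^ (-H) * (n : ℝ) ^ (-H)) *
        ∑ s ∈ Finset.Icc (1 : ℤ) n, ∑ t ∈ Finset.Icc (1 : ℤ) n,
          (F n (ξ s ω) * F n (ξ t ω)) * (u s ω * u t ω) := by
      intro ω
      simp only [hW]
      rw [mul_pow, sq, sq, Finset.sum_mul_sum]
      congr 1
      exact Finset.sum_congr rfl fun s _ => Finset.sum_congr rfl fun t _ => by ring
    have e2 : (n : ℝ) ^ (-H) * (n : ℝ) ^ (-H) = (n : ℝ) ^ (-(2 * H)) := by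
      rw [← Real.rpow_add' (Nat.cast_nonneg n) (by linarith)]; ring_nf
    simp_rw [e]
    rw [integral_const_mul, e2, integral_finsetSum _ fun s _ =>
      integrable_finsetSum _ fun t _ => hint n s t]
    congr 1
    refine Finset.sum_congr rfl fun s _ => ?_
    rw [integral_finsetSum _ fun t _ => hint n s t]
    refine Finset.sum_congr rfl fun t _ => ?_
    rw [(hind1 n s t).integral_fun_mul_eq_mul_integral
      ((hFξ n s).1.mul (hFξ n t).1) ((hu s).1.mul (hu t).1), hγ,
      hξ.stationary.integral_mul (hFm n)]
  have hWlim : TendstoInMeasure P W atTop (fun _ => 0) := by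
    refine tendstoInMeasure_zero_of_tendsto_integral_sq hWm ?_
    simp_rw [hWsq]
    exact tendsto_sum_sum_mul_zero haB hγc hBlim halim hM
  refine tendstoInMeasure_of_tendsto_measureReal_ne ?_ hWlim
  refine squeeze_zero (fun _ => measureReal_nonneg) (fun n => measureReal_mono fun ω hω => ?_)
    (hξ.tendsto_measureReal_exists_gt hδ)
  by_contra hno
  simp only [Set.mem_ofPred_eq, not_exists, not_and, not_lt] at hno
  refine hω ?_
  simp only [hW]
  congr 1
  refine Finset.sum_congr rfl fun t ht => ?_
  simp only [hF]
  rw [if_pos (hno t ht)]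

end IsMixingStdGaussian

/-! ### Reduction of the design to a standardized process -/

section Design

variable {Ω : Type*} [MeasurableSpace Ω] {P : Measure Ω} [IsProbabilityMeasure P]
  {X : ℤ → Ω → ℝ}

theorem isMixingStdGaussian_standardize (hXm : ∀ t, Measurable (X t))
    (hX : IsGaussianProcess X P) (hs : IsStrictlyStationary X P) (hv : 0 < Var[X 0; P])
    (hcov : Tendsto (autoCov X P) atTop (𝓝 0)) :
    IsMixingStdGaussian (fun t ω => (√Var[X 0; P])⁻¹ * (X t ω - ∫ ω, X 0 ω ∂P)) P := by
  set m := ∫ ω, X 0 ω ∂P with hm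
  set r := (√Var[X 0; P])⁻¹ with hr
  have hr2 : r ^ 2 * Var[X 0; P] = 1 := by
    rw [hr, inv_pow, Real.sq_sqrt hv.le, inv_mul_cancel₀ hv.ne']
  have hL : ∀ t, MemLp (X t) 2 P := fun t => (hX.hasGaussianLaw_eval t).memLp_two
  have hLc : ∀ t, MemLp (fun ω => X t ω - m) 2 P := fun t => (hL t).sub (memLp_const m)
  have hcc : ∀ s t, cov[fun ω => r * (X s ω - m), fun ω => r * (X t ω - m); P]
      = r ^ 2 * cov[X s, X t; P] := by
    intro s t
    rw [covariance_const_mul_left, covariance_const_mul_right,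
      covariance_sub_const_left ((hL s).integrable one_le_two),
      covariance_sub_const_right ((hL t).integrable one_le_two)]
    ring
  refine ⟨fun t => ((hXm t).sub_const m).const_mul r, fun s t => ?_, fun k => ?_, ?_, ?_, ?_⟩
  · have h1 : HasGaussianLaw (fun ω => (X s ω, X t ω)) P := hX.hasGaussianLaw_prodMk
    have h2 : HasGaussianLaw (fun ω => (X s ω, X t ω) + (-m, -m)) P := by
      refine ⟨?_⟩
      have := h1.isGaussian_map
      have h3 : IsGaussian ((P.map fun ω => (X s ω, X t ω)).map (fun p => p + (-m, -m))) :=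
        inferInstance
      rwa [AEMeasurable.map_map_of_aemeasurable (by fun_prop) h1.aemeasurable] at h3
    have h4 := h2.map_fun (r • ContinuousLinearMap.id ℝ (ℝ × ℝ))
    simpa [sub_eq_add_neg] using h4
  · exact (hs k).comp (u := fun (e : ℤ → ℝ) (t : ℤ) => r * (e t - m)) (by fun_prop)
  · rw [integral_const_mul, integral_sub ((hL 0).integrable one_le_two) (integrable_const m)]
    simp [hm]
  · have h := hcc 0 0
    rw [covariance_self (by fun_prop), covariance_self (by fun_prop)] at h
    rw [h, hr2]
  · have h := hcov.const_mul (r ^ 2)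
    rw [mul_zero] at h
    exact h.congr fun k => (hcc 0 k).symm

/-- For a function `τ` of the design with `τ(X₀)` slightly less than square integrable, replacing
`τ(X_t)` by its mean changes `∑ τ(X_t) u_t` by less than the order of `∑ u_t`. -/
theorem tendstoInMeasure_sum_centered_mul (hXm : ∀ t, Measurable (X t))
    (hX : IsGaussianProcess X P) (hs : IsStrictlyStationary X P) (hv : 0 < Var[X 0; P])
    (hcov : Tendsto (autoCov X P) atTop (𝓝 0)) {u : ℤ → Ω → ℝ} (hu : ∀ t, MemLp (u t) 2 P)
    (hind : ∀ s t, IndepFun (fun ω => (u s ω, u t ω)) (fun ω t => X t ω) P)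
    {γ : ℕ → ℝ} (hγ : ∀ s t, ∫ ω, u s ω * u t ω ∂P = γ (s - t).natAbs) {c M H : ℝ}
    (hγc : ∀ k, |γ k| ≤ c) (hH : 1 / 2 < H)
    (hM : ∀ᶠ n : ℕ in atTop, (n : ℝ) ^ (-(2 * H)) * ∑ s ∈ Finset.Icc (1 : ℤ) n,
      ∑ t ∈ Finset.Icc (1 : ℤ) n, |γ (s - t).natAbs| ≤ M)
    {τ w : ℝ → ℝ} (hτ : Measurable τ) (hτw : ∀ x, |τ x| ≤ (1 + |x|) * w x) (hw : Measurable w)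
    (hwL : MemLp (fun ω => w (X 0 ω)) 2 P) :
    TendstoInMeasure P (fun (n : ℕ) ω => (n : ℝ) ^ (-H) * ∑ t ∈ Finset.Icc (1 : ℤ) n,
      (τ (X t ω) - ∫ ω, τ (X 0 ω) ∂P) * u t ω) atTop (fun _ => 0) := by
  obtain ⟨m, sd, hsd0, hξ⟩ : ∃ m sd : ℝ, 0 < sd ∧
      IsMixingStdGaussian (fun t ω => sd⁻¹ * (X t ω - m)) P :=
    ⟨_, _, Real.sqrt_pos.2 hv, isMixingStdGaussian_standardize hXm hX hs hv hcov⟩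
  obtain ⟨ξ, hξdef⟩ : ∃ ξ : ℤ → Ω → ℝ, ξ = fun t ω => sd⁻¹ * (X t ω - m) := ⟨_, rfl⟩
  rw [← hξdef] at hξ
  have hXξ : ∀ t ω, m + sd * ξ t ω = X t ω := by
    intro t ω
    simp only [hξdef]
    field_simp
    ring
  set T := ∫ ω, τ (X 0 ω) ∂P with hT
  have hw0 : ∀ x, 0 ≤ w x := fun x =>
    nonneg_of_mul_nonneg_right ((abs_nonneg _).trans (hτw x)) (by positivity)
  have hτm : Measurable (fun x => τ (m + sd * x)) := by fun_prop
  have hwm : Measurable (fun x => w (m + sd * x)) := by fun_prop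
  have hτint : Integrable (fun ω => τ (X 0 ω)) P := by
    have hXL : MemLp (X 0) 2 P := (hX.hasGaussianLaw_eval 0).memLp_two
    have hX1 : MemLp (fun ω => |X 0 ω|) 2 P := hXL.norm
    have hX0 : MemLp (fun ω => 1 + |X 0 ω|) 2 P :=
      MemLp.add (f := fun _ => (1 : ℝ)) (memLp_const 1) hX1
    exact (hX0.integrable_mul hwL).mono' (hτ.comp (hXm 0)).aestronglyMeasurable
      (Eventually.of_forall fun ω => hτw (X 0 ω))
  have hmap0 := hξ.map_eq 0
  have hwγ : MemLp (fun x => w (m + sd * x)) 2 (gaussianReal 0 1) := by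
    rw [← hmap0, memLp_map_measure_iff hwm.aestronglyMeasurable (hξ.measurable 0).aemeasurable]
    have e : (fun x => w (m + sd * x)) ∘ ξ 0 = fun ω => w (X 0 ω) := by
      funext ω
      simp only [Function.comp, hXξ]
    rw [e]
    exact hwL
  have hind' : ∀ s t, IndepFun (fun ω => (u s ω, u t ω)) (fun ω => (ξ s ω, ξ t ω)) P := by
    intro s t
    rw [hξdef]
    exact (hind s t).comp (ψ := fun e : ℤ → ℝ => (sd⁻¹ * (e s - m), sd⁻¹ * (e t - m)))
      measurable_id (by fun_prop)
  have h := hξ.tendstoInMeasure_sum_mul hu hind' hγ hγc hH hM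
    (f := fun x => τ (m + sd * x) - T) (g := fun x => (1 + |m| + sd) * w (m + sd * x) + |T|)
    (hτm.sub_const T) ?_ ((hwγ.const_mul _).add (memLp_const _)) ?_
  · simpa only [hXξ] using h
  · intro x
    have h1 : |m + sd * x| ≤ |m| + sd * |x| := by
      refine (abs_add_le _ _).trans_eq ?_
      rw [abs_mul, abs_of_pos hsd0]
    have h2 : 1 + |m + sd * x| ≤ (1 + |x|) * (1 + |m| + sd) := by
      nlinarith [abs_nonneg x, abs_nonneg m, mul_nonneg (abs_nonneg x) (abs_nonneg m)]
    calc |τ (m + sd * x) - T| ≤ |τ (m + sd * x)| + |T| := abs_sub _ _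
      _ ≤ (1 + |m + sd * x|) * w (m + sd * x) + 1 * |T| := by
          rw [one_mul]; gcongr; exact hτw _
      _ ≤ ((1 + |x|) * (1 + |m| + sd)) * w (m + sd * x) + (1 + |x|) * |T| := by
          have := hw0 (m + sd * x)
          gcongr
          linarith [abs_nonneg x]
      _ = _ := by ring
  · rw [← hξ.integral_comp (hτm.sub_const T) 0]
    simp only [hXξ]
    rw [integral_sub hτint (integrable_const T)]
    simp [hT]

/-- Weak law of large numbers for functions of the design. -/
theorem tendstoInMeasure_mean (hXm : ∀ t, Measurable (X t))
    (hX : IsGaussianProcess X P) (hs : IsStrictlyStationary X P) (hv : 0 < Var[X 0; P])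
    (hcov : Tendsto (autoCov X P) atTop (𝓝 0)) {τ w : ℝ → ℝ} (hτ : Measurable τ)
    (hτw : ∀ x, |τ x| ≤ (1 + |x|) * w x) (hw : Measurable w)
    (hwL : MemLp (fun ω => w (X 0 ω)) 2 P) :
    TendstoInMeasure P (fun (n : ℕ) ω => (n : ℝ) ^ (-(1 : ℝ)) * ∑ t ∈ Finset.Icc (1 : ℤ) n,
      (τ (X t ω) - ∫ ω, τ (X 0 ω) ∂P)) atTop (fun _ => 0) := by
  have h := tendstoInMeasure_sum_centered_mul hXm hX hs hv hcov (u := fun _ _ => 1)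
    (fun _ => memLp_const 1) (fun s t => (indepFun_const_left _ _)) (γ := fun _ => 1)
    (by simp) (c := 1) (M := 1) (H := 1) (by simp) (by norm_num) ?_ hτ hτw hw hwL
  · simpa only [mul_one] using h
  · filter_upwards [eventually_gt_atTop 0] with n hn
    have hn' : (0 : ℝ) < n := by exact_mod_cast hn
    have e : ∑ s ∈ Finset.Icc (1 : ℤ) n, ∑ t ∈ Finset.Icc (1 : ℤ) n, |(1 : ℝ)| = n * n := by
      simp
    rw [e, Real.rpow_neg hn'.le, mul_one, Real.rpow_two]
    exact le_of_eq (by field_simp)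

end Design

/-! ### The normal equations -/

theorem eq_zero_of_forall_quadratic_nonneg {A B : ℝ} (hB : 0 ≤ B)
    (h : ∀ x : ℝ, 0 ≤ x ^ 2 * B - 2 * x * A) : A = 0 := by
  have h1 := h (A / (B + 1))
  have h2 : (A / (B + 1)) ^ 2 * B - 2 * (A / (B + 1)) * A
      = -(A ^ 2 * (B + 2)) / (B + 1) ^ 2 := by
    field_simp
    ring
  rw [h2, div_nonneg_iff] at h1
  have h3 : 0 < (B + 1) ^ 2 := by positivity
  rcases h1 with ⟨h4, -⟩ | ⟨-, h4⟩
  · have : A ^ 2 * (B + 2) ≤ 0 := by linarith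
    have hA : A ^ 2 ≤ 0 := by nlinarith [sq_nonneg A]
    nlinarith [sq_nonneg A]
  · linarith

theorem sum_mul_eq_zero_of_forall_le {ι : Type*} (s : Finset ι) (r z : ι → ℝ)
    (h : ∀ x : ℝ, ∑ i ∈ s, r i ^ 2 ≤ ∑ i ∈ s, (r i - x * z i) ^ 2) : ∑ i ∈ s, r i * z i = 0 := by
  refine eq_zero_of_forall_quadratic_nonneg (B := ∑ i ∈ s, z i ^ 2)
    (Finset.sum_nonneg fun _ _ => sq_nonneg _) fun x => ?_
  have h1 := h x
  have h2 : ∑ i ∈ s, (r i - x * z i) ^ 2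
      = ∑ i ∈ s, r i ^ 2 + (x ^ 2 * ∑ i ∈ s, z i ^ 2 - 2 * x * ∑ i ∈ s, r i * z i) := by
    rw [Finset.mul_sum, Finset.mul_sum, ← Finset.sum_sub_distrib, ← Finset.sum_add_distrib]
    exact Finset.sum_congr rfl fun i _ => by ring
  linarith

theorem IsLeastSquaresEstimate.sum_residual {x y : ℤ → ℝ} {n : ℕ} {b₀ b₁ : ℝ}
    (h : IsLeastSquaresEstimate x y n b₀ b₁) :
    ∑ t ∈ Finset.Icc (1 : ℤ) n, (y t - b₀ - b₁ * x t) = 0 := by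
  have := sum_mul_eq_zero_of_forall_le (Finset.Icc (1 : ℤ) n) (fun t => y t - b₀ - b₁ * x t)
    (fun _ => 1) fun c => by
      refine (h (b₀ + c) b₁).trans_eq (Finset.sum_congr rfl fun t _ => by ring)
  simpa using this

theorem IsLeastSquaresEstimate.sum_residual_mul {x y : ℤ → ℝ} {n : ℕ} {b₀ b₁ : ℝ}
    (h : IsLeastSquaresEstimate x y n b₀ b₁) :
    ∑ t ∈ Finset.Icc (1 : ℤ) n, (y t - b₀ - b₁ * x t) * x t = 0 :=
  sum_mul_eq_zero_of_forall_le (Finset.Icc (1 : ℤ) n) (fun t => y t - b₀ - b₁ * x t) x fun c => by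
    refine (h b₀ (b₁ + c)).trans_eq (Finset.sum_congr rfl fun t _ => by ring)

/-- Solutions `D` of perturbed normal equations, with Gram matrix tending in probability to the
invertible matrix `!![1, μ; μ, q]` and right-hand side asymptotically `(a, J) U`, converge in
distribution to the solution of the limiting equations. -/
theorem tendstoInDistribution_of_normal_equations {Ω : Type*} [MeasurableSpace Ω] {P : Measure Ω}
    [IsProbabilityMeasure P] {ν : Measure ℝ} [IsProbabilityMeasure ν]
    {U R₀ R₁ m s D₀ D₁ : ℕ → Ω → ℝ} {μ q a J v : ℝ} (hv : 0 < v) (hvq : v = q - μ ^ 2)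
    (hU : TendstoInDistribution U atTop (fun z : ℝ => z) (fun _ => P) ν)
    (hR₀ : TendstoInMeasure P R₀ atTop (fun _ => 0)) (hR₀m : ∀ n, AEMeasurable (R₀ n) P)
    (hR₁ : TendstoInMeasure P R₁ atTop (fun _ => 0)) (hR₁m : ∀ n, AEMeasurable (R₁ n) P)
    (hm : TendstoInMeasure P m atTop (fun _ => 0)) (hmm : ∀ n, AEMeasurable (m n) P)
    (hs : TendstoInMeasure P s atTop (fun _ => 0)) (hsm : ∀ n, AEMeasurable (s n) P)
    (hD₀m : ∀ n, AEMeasurable (D₀ n) P) (hD₁m : ∀ n, AEMeasurable (D₁ n) P)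
    (hne : ∀ᶠ n in atTop, ∀ᵐ ω ∂P,
      D₀ n ω + (m n ω + μ) * D₁ n ω = a * U n ω + R₀ n ω ∧
      (m n ω + μ) * D₀ n ω + (s n ω + q) * D₁ n ω = J * U n ω + R₁ n ω) :
    TendstoInDistribution (fun n ω => (D₀ n ω, D₁ n ω)) atTop
      (fun z : ℝ => ((a - (J - μ * a) * μ / v) * z, (J - μ * a) / v * z)) (fun _ => P) ν := by
  have hU1 := hU.prodMk_of_tendstoInMeasure_const _ _ _ hR₀ hR₀m
  have hU2 := hU1.prodMk_of_tendstoInMeasure_const _ _ _ hR₁ hR₁m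
  have hU3 := hU2.prodMk_of_tendstoInMeasure_const _ _ _ hm hmm
  have hU4 := hU3.prodMk_of_tendstoInMeasure_const _ _ _ hs hsm
  -- the slope and the pair of coefficients, with the determinant kept away from zero
  let slope : (((ℝ × ℝ) × ℝ) × ℝ) × ℝ → ℝ := fun x =>
    ((J * x.1.1.1.1 + x.1.1.2) - (x.1.2 + μ) * (a * x.1.1.1.1 + x.1.1.1.2)) /
      max ((x.2 + q) - (x.1.2 + μ) ^ 2) (v / 2)
  let G : (((ℝ × ℝ) × ℝ) × ℝ) × ℝ → ℝ × ℝ := fun x =>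
    ((a * x.1.1.1.1 + x.1.1.1.2) - (x.1.2 + μ) * slope x, slope x)
  have hslope : Continuous slope :=
    Continuous.div (by fun_prop) (by fun_prop)
      (fun x => (lt_max_of_lt_right (by linarith : 0 < v / 2)).ne')
  have hG : Continuous G := by fun_prop
  have hlim := hU4.continuous_comp hG
  have hmax' : max (0 + q - (0 + μ) ^ 2) (v / 2) = v := by
    rw [zero_add, zero_add, ← hvq]; exact max_eq_left (by linarith)
  have hlimit : (G ∘ fun z : ℝ => ((((z, (0 : ℝ)), (0 : ℝ)), (0 : ℝ)), (0 : ℝ)))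
      = fun z : ℝ => ((a - (J - μ * a) * μ / v) * z, (J - μ * a) / v * z) := by
    funext z
    have hsl : slope ((((z, (0 : ℝ)), (0 : ℝ)), (0 : ℝ)), (0 : ℝ)) = (J - μ * a) / v * z := by
      simp only [slope, hmax']
      ring
    simp only [Function.comp, G, hsl]
    congr 1
    ring
  rw [hlimit] at hlim
  refine tendstoInDistribution_of_tendstoInMeasure_sub _ _ hlim ?_
    (fun n => (hD₀m n).prodMk (hD₁m n))
  refine tendstoInMeasure_of_tendsto_measureReal_ne (g := fun _ _ => 0) ?_
    (by rw [tendstoInMeasure_iff_measureReal_norm]; intro r hr; simp [not_le.2 hr])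
  -- off an event of small probability the determinant exceeds `v / 2`
  set r := min 1 (v / (4 * (2 + 2 * |μ|))) with hr
  have hr0 : 0 < r := by
    have : 0 ≤ |μ| := abs_nonneg μ
    positivity
  have hr1 : r ≤ 1 := min_le_left _ _
  have hr2 : r * (2 + 2 * |μ|) ≤ v / 4 := by
    have h2 : r ≤ v / (4 * (2 + 2 * |μ|)) := min_le_right _ _
    have h3 : 0 ≤ |μ| := abs_nonneg μ
    calc _ ≤ v / (4 * (2 + 2 * |μ|)) * (2 + 2 * |μ|) := by gcongr
      _ = v / 4 := by field_simp
  have h1 := (tendstoInMeasure_iff_measureReal_norm.1 hm r hr0).add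
    (tendstoInMeasure_iff_measureReal_norm.1 hs r hr0)
  rw [add_zero] at h1
  refine squeeze_zero' (Eventually.of_forall fun _ => measureReal_nonneg) ?_ h1
  filter_upwards [hne] with n hn
  refine le_trans ?_ (measureReal_union_le _ _)
  refine ENNReal.toReal_mono (measure_ne_top _ _) (measure_mono_ae ?_)
  filter_upwards [hn] with ω hω hneq
  by_contra hno
  refine hneq ?_
  have hno' : ¬(r ≤ |m n ω| ∨ r ≤ |s n ω|) := by
    intro h
    refine hno ?_
    rcases h with h | h
    · left; simpa [Real.norm_eq_abs] using h
    · right; simpa [Real.norm_eq_abs] using h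
  push Not at hno'
  obtain ⟨hmr, hsr⟩ := hno'
  have hdet : v / 2 < (s n ω + q) - (m n ω + μ) ^ 2 := by
    have e : (s n ω + q) - (m n ω + μ) ^ 2 = v + (s n ω - m n ω ^ 2 - 2 * (m n ω * μ)) := by
      rw [hvq]; ring
    have b1 : -r ≤ s n ω := by linarith [neg_abs_le (s n ω)]
    have b2 : m n ω ^ 2 ≤ r := by
      rw [← sq_abs]; nlinarith [abs_nonneg (m n ω)]
    have b3 : m n ω * μ ≤ r * |μ| := by
      refine (le_abs_self _).trans ?_
      rw [abs_mul]
      gcongr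
    rw [e]
    nlinarith
  obtain ⟨e1, e2⟩ := hω
  have hdet0 : (s n ω + q) - (m n ω + μ) ^ 2 ≠ 0 := by linarith
  have hsl : slope ((((U n ω, R₀ n ω), R₁ n ω), m n ω), s n ω) = D₁ n ω := by
    simp only [slope]
    rw [max_eq_left hdet.le, div_eq_iff hdet0, ← e1, ← e2]
    ring
  simp only [Pi.sub_apply, Function.comp, G, hsl]
  rw [← e1]
  ext <;> simp

/-! ### Constants and asymptotic equivalence -/

theorem theta_pos {a : ℝ} (h1 : 1 / 2 < a) (h2 : a < 1) : 0 < theta a := by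
  unfold theta
  have hπ := Real.pi_pos
  have h3 : 0 < Real.Gamma (2 - 2 * a) := Real.Gamma_pos_of_pos (by linarith)
  have h4 : 0 < Real.cos (Real.pi * (1 - a)) :=
    Real.cos_pos_of_mem_Ioo ⟨by nlinarith, by nlinarith⟩
  positivity

theorem isEquivalent_const_mul_rpow_iff {f : ℕ → ℝ} {K r : ℝ} (hK : K ≠ 0) :
    (f ~[atTop] fun k : ℕ => K * (k : ℝ) ^ (-r)) ↔
      Tendsto (fun k : ℕ => f k * (k : ℝ) ^ r) atTop (𝓝 K) := by
  rw [isEquivalent_iff_tendsto_one]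
  · have e : (fun k : ℕ => f k * (k : ℝ) ^ r) =ᶠ[atTop]
        fun k => K * (f / fun k : ℕ => K * (k : ℝ) ^ (-r)) k := by
      filter_upwards [eventually_gt_atTop 0] with k hk
      have hk' : (0 : ℝ) < k := by exact_mod_cast hk
      have := (Real.rpow_pos_of_pos hk' r).ne'
      rw [Pi.div_apply, Real.rpow_neg hk'.le]
      field_simp
    rw [tendsto_congr' e]
    constructor
    · intro h
      simpa using h.const_mul K
    · intro h
      have h' := h.const_mul K⁻¹
      simp only [← mul_assoc, inv_mul_cancel₀ hK, one_mul] at h'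
      exact h'
  · filter_upwards [eventually_gt_atTop 0] with k hk
    have hk' : (0 : ℝ) < k := by exact_mod_cast hk
    exact mul_ne_zero hK (Real.rpow_pos_of_pos hk' _).ne'

theorem variance_pos_of_autoCov {Ω : Type*} [MeasurableSpace Ω] {P : Measure Ω}
    [IsProbabilityMeasure P] {X : ℤ → Ω → ℝ} (hX : MemLp (X 0) 2 P) {K r : ℝ} (hK : 0 < K)
    (h : autoCov X P ~[atTop] fun k : ℕ => K / (k : ℝ) ^ r) : 0 < Var[X 0; P] := by
  refine (variance_nonneg _ _).lt_of_ne fun h0 => ?_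
  have hae := ae_eq_integral_of_variance_eq_zero hX h0.symm
  have hz : autoCov X P = 0 := by
    funext k
    rw [autoCov, Pi.zero_apply, covariance, ← integral_zero Ω ℝ (μ := P)]
    refine integral_congr_ae ?_
    filter_upwards [hae] with ω hω
    rw [hω]; simp
  rw [hz] at h
  obtain ⟨k, hk, hk0⟩ := ((isEquivalent_zero_iff_eventually_zero.1 h.symm).and
    (eventually_gt_atTop 0)).exists
  have hk' : (0 : ℝ) < k := by exact_mod_cast hk0
  have : 0 < K / (k : ℝ) ^ r := by positivity
  exact this.ne' hk

theorem Gamma1_eq_zero {Ω : Type*} [MeasurableSpace Ω] {P : Measure Ω} [IsProbabilityMeasure P]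
    {X : Ω → ℝ} (hX : HasGaussianLaw X P) {σ : ℝ → ℝ} (hσm : Measurable σ)
    (h : (∃ c : ℝ, ∀ x, σ x = c) ∨ (P[X] = 0 ∧ ∀ x, σ (-x) = σ x)) : Gamma1 X σ P = 0 := by
  unfold Gamma1
  rcases h with ⟨c, hc⟩ | ⟨h0, heven⟩
  · simp only [hc]
    rw [integral_mul_const]
    simp
  · have hmap : P.map X = gaussianReal 0 Var[X; P].toNNReal := by
      rw [hX.map_eq_gaussianReal, h0]
    have hm : Measurable (fun x => x * σ x) := by fun_prop
    -- the law of `X` is symmetric and `x ↦ x σ(x)` is odd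
    have hE : ∫ ω, X ω * σ (X ω) ∂P = ∫ x, x * σ x ∂gaussianReal 0 Var[X; P].toNNReal := by
      rw [← hmap, integral_map hX.aemeasurable hm.aestronglyMeasurable]
    have hsym : ∫ x, x * σ x ∂gaussianReal 0 Var[X; P].toNNReal
        = -∫ x, x * σ x ∂gaussianReal 0 Var[X; P].toNNReal := by
      have hneg : (gaussianReal 0 Var[X; P].toNNReal).map (fun x => -x)
          = gaussianReal 0 Var[X; P].toNNReal := by
        rw [gaussianReal_map_neg, neg_zero]
      conv_lhs => rw [← hneg]
      rw [integral_map (by fun_prop) hm.aestronglyMeasurable, ← integral_neg]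
      simp only [heven, neg_mul]
    have hzero : ∫ ω, X ω * σ (X ω) ∂P = 0 := by rw [hE]; linarith
    rw [hzero, h0]
    simp

/-! ### Long memory of the errors -/

/-- The auto-covariances of a moving average inherit the power decay of its coefficients. -/
theorem IsMovingAverage.exists_tendsto_autoCov {Ω : Type*} [MeasurableSpace Ω] {P : Measure Ω}
    [IsProbabilityMeasure P] {H C : ℝ} (hH : 1 / 2 < H ∧ H < 1) {ε u : ℤ → Ω → ℝ} {b : ℕ → ℝ}
    (hε : IsStandardizedIID ε P) (hu : IsMovingAverage b ε u P) (hC : C ≠ 0)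
    (hb : b ~[atTop] fun j : ℕ => C * (j : ℝ) ^ (-(3 / 2 - H)))
    (hb_sq : Summable fun j => b j ^ 2) :
    ∃ K : ℝ, 0 < K ∧
      Tendsto (fun k : ℕ => autoCov u P k * (k : ℝ) ^ (2 * (1 - H))) atTop (𝓝 K) := by
  obtain ⟨K, hK, h⟩ := exists_tendsto_autocorrelation (p := 3 / 2 - H) (by linarith [hH.2])
    (by linarith [hH.1]) hC ((isEquivalent_const_mul_rpow_iff hC).1 hb)
  refine ⟨K, hK, h.congr fun k => ?_⟩
  rw [hu.autoCov_eq hε hb_sq, mul_comm]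
  congr 2
  ring

/-! ### Asymptotics of the least squares estimator -/

/-- The least squares estimates, rescaled by `n^{1-H}`, satisfy the normal equations whose
right-hand sides are the sums of `σ(X_t) u_t` and `X_t σ(X_t) u_t`, each split into the
contribution of the mean of the factor of `u_t` and a remainder. -/
theorem normal_equations_rescaled {x e y u : ℤ → ℝ} {n : ℕ} (hn : 0 < n) {β₀ β₁ b₀ b₁ H : ℝ}
    (hy : ∀ t, y t = β₀ + β₁ * x t + e t * u t)
    (h : IsLeastSquaresEstimate x y n b₀ b₁) (μ q a J : ℝ) :
    (n : ℝ) ^ (1 - H) * (b₀ - β₀)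
        + ((n : ℝ) ^ (-(1 : ℝ)) * ∑ t ∈ Finset.Icc (1 : ℤ) n, (x t - μ) + μ)
          * ((n : ℝ) ^ (1 - H) * (b₁ - β₁))
      = a * ((n : ℝ) ^ (-H) * ∑ t ∈ Finset.Icc (1 : ℤ) n, u t)
        + (n : ℝ) ^ (-H) * ∑ t ∈ Finset.Icc (1 : ℤ) n, (e t - a) * u t ∧
    ((n : ℝ) ^ (-(1 : ℝ)) * ∑ t ∈ Finset.Icc (1 : ℤ) n, (x t - μ) + μ)
          * ((n : ℝ) ^ (1 - H) * (b₀ - β₀))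
        + ((n : ℝ) ^ (-(1 : ℝ)) * ∑ t ∈ Finset.Icc (1 : ℤ) n, (x t ^ 2 - q) + q)
          * ((n : ℝ) ^ (1 - H) * (b₁ - β₁))
      = J * ((n : ℝ) ^ (-H) * ∑ t ∈ Finset.Icc (1 : ℤ) n, u t)
        + (n : ℝ) ^ (-H) * ∑ t ∈ Finset.Icc (1 : ℤ) n, (x t * e t - J) * u t := by
  have hn' : (0 : ℝ) < n := by exact_mod_cast hn
  have hcard : ∀ c : ℝ, ∑ t ∈ Finset.Icc (1 : ℤ) n, c = n * c := fun c => by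
    rw [Finset.sum_const, Int.card_Icc, nsmul_eq_mul]; simp
  have h1 : ∑ t ∈ Finset.Icc (1 : ℤ) n, e t * u t
      = n * (b₀ - β₀) + (b₁ - β₁) * ∑ t ∈ Finset.Icc (1 : ℤ) n, x t := by
    have := h.sum_residual
    rw [← hcard, Finset.mul_sum, ← Finset.sum_add_distrib, ← sub_eq_zero,
      ← Finset.sum_sub_distrib, ← this]
    exact Finset.sum_congr rfl fun t _ => by rw [hy]; ring
  have h2 : ∑ t ∈ Finset.Icc (1 : ℤ) n, x t * e t * u t
      = (b₀ - β₀) * ∑ t ∈ Finset.Icc (1 : ℤ) n, x t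
        + (b₁ - β₁) * ∑ t ∈ Finset.Icc (1 : ℤ) n, x t ^ 2 := by
    have := h.sum_residual_mul
    rw [Finset.mul_sum, Finset.mul_sum, ← Finset.sum_add_distrib, ← sub_eq_zero,
      ← Finset.sum_sub_distrib, ← this]
    exact Finset.sum_congr rfl fun t _ => by rw [hy]; ring
  have hpow : (n : ℝ) ^ (1 - H) = (n : ℝ) ^ (-H) * n := by
    rw [sub_eq_add_neg, add_comm, Real.rpow_add hn', Real.rpow_one]
  simp only [sub_mul, Finset.sum_sub_distrib, hcard, ← Finset.mul_sum, h1, h2, hpow,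
    Real.rpow_neg_one]
  constructor <;> field_simp <;> ring

end LongMemoryRegression

theorem lemma2p1 {Ω : Type*} [MeasurableSpace Ω] (P : Measure Ω) [IsProbabilityMeasure P]
    (H h : ℝ) (hH : 1 / 2 < H ∧ H < 1) (hh : 1 / 2 < h ∧ h < 1)
    -- the standardized i.i.d. innovations and the moving average errors
    (ε u : ℤ → Ω → ℝ) (hε : LongMemoryRegression.IsStandardizedIID ε P)
    (b : ℕ → ℝ) (C : ℝ) (hC : C ≠ 0)
    (hb : b ~[atTop] fun j : ℕ => C * (j : ℝ) ^ (-(3 / 2 - H)))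
    (hb_sq : HasSum (fun j => b j ^ 2) 1)
    (hu : LongMemoryRegression.IsMovingAverage b ε u P)
    -- the stationary long memory Gaussian design, independent of the innovations
    (X : ℤ → Ω → ℝ) (hX_meas : ∀ t, Measurable (X t)) (hX_gauss : IsGaussianProcess X P)
    (hX_stat : LongMemoryRegression.IsStrictlyStationary X P)
    (G_X : ℝ) (hG_X : 0 < G_X)
    (hX_cov : LongMemoryRegression.autoCov X P ~[atTop]
      fun k : ℕ => G_X * LongMemoryRegression.theta h / (k : ℝ) ^ (2 * (1 - h)))
    (hX_indep : IndepFun (fun ω t => ε t ω) (fun ω t => X t ω) P)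
    -- the heteroscedastic linear regression model
    (σ : ℝ → ℝ) (hσ_meas : Measurable σ) (hσ : MemLp (fun ω => σ (X 0 ω)) 2 P)
    (β₀ β₁ : ℝ) (Y : ℤ → Ω → ℝ)
    (hY : ∀ t, ∀ᵐ ω ∂P, Y t ω = β₀ + β₁ * X t ω + σ (X t ω) * u t ω)
    -- the least squares estimators
    (βhat₀ βhat₁ : ℕ → Ω → ℝ)
    (hβhat₀ : ∀ n, AEMeasurable (βhat₀ n) P) (hβhat₁ : ∀ n, AEMeasurable (βhat₁ n) P)
    (hβhat : ∀ n, ∀ᵐ ω ∂P, LongMemoryRegression.IsLeastSquaresEstimate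
      (fun t => X t ω) (fun t => Y t ω) n (βhat₀ n ω) (βhat₁ n ω)) :
    -- the limit `Z₁` is the identity on `ℝ` under the law `N(0, G_u * D(H))`
    (∃ G_u : ℝ, 0 < G_u ∧
      (LongMemoryRegression.autoCov u P ~[atTop]
        fun k : ℕ => G_u * LongMemoryRegression.theta H * (k : ℝ) ^ (-(2 * (1 - H)))) ∧
      TendstoInDistribution
        (fun (n : ℕ) ω => (n : ℝ) ^ (-H) * ∑ t ∈ Finset.Icc (1 : ℤ) n, u t ω) atTop
        (fun z : ℝ => z) (fun _ => P)
        (gaussianReal 0 (G_u * LongMemoryRegression.dConst H).toNNReal) ∧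
      TendstoInDistribution
        (fun (n : ℕ) ω =>
          ((n : ℝ) ^ (1 - H) * (βhat₀ n ω - β₀), (n : ℝ) ^ (1 - H) * (βhat₁ n ω - β₁))) atTop
        (fun z : ℝ => (LongMemoryRegression.Gamma0 (X 0) σ P * z,
          LongMemoryRegression.Gamma1 (X 0) σ P * z)) (fun _ => P)
        (gaussianReal 0 (G_u * LongMemoryRegression.dConst H).toNNReal)) ∧
    -- degeneracy of the limit of the slope
    (((∃ c : ℝ, ∀ x, σ x = c) ∨ (P[X 0] = 0 ∧ ∀ x, σ (-x) = σ x)) →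
      LongMemoryRegression.Gamma1 (X 0) σ P = 0 ∧
      TendstoInDistribution
        (fun (n : ℕ) ω => (n : ℝ) ^ (1 - H) * (βhat₁ n ω - β₁)) atTop
        (fun _ : Ω => (0 : ℝ)) (fun _ => P) P) := by
  have hCovX : Tendsto (LongMemoryRegression.autoCov X P) atTop (𝓝 0) := by
    refine hX_cov.symm.tendsto_nhds ?_
    exact tendsto_const_nhds.div_atTop ((tendsto_rpow_atTop (by linarith [hh.2])).comp
      (tendsto_natCast_atTop_atTop (R := ℝ)))
  have hXL : ∀ t, MemLp (X t) 2 P := fun t => (hX_gauss.hasGaussianLaw_eval t).memLp_two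
  have hv : 0 < Var[X 0; P] := LongMemoryRegression.variance_pos_of_autoCov (hXL 0)
    (mul_pos hG_X (LongMemoryRegression.theta_pos hh.1 hh.2)) hX_cov
  obtain ⟨K, hK, hγ⟩ := hu.exists_tendsto_autoCov hH hε hC hb hb_sq.summable
  have hθ := LongMemoryRegression.theta_pos hH.1 hH.2
  -- second order properties of the errors
  have huL : ∀ t, MemLp (u t) 2 P := fun t => hu.memLp hε t
  have hind : ∀ s t, IndepFun (fun ω => (u s ω, u t ω)) (fun ω t => X t ω) P := fun s t =>
    hu.indepFun_prodMk hε hX_indep s t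
  have huγ : ∀ s t, ∫ ω, u s ω * u t ω ∂P = LongMemoryRegression.autoCov u P (s - t).natAbs :=
    fun s t => hu.integral_mul hε hb_sq.summable s t
  have hr0 : 0 < 2 * (1 - H) := by linarith [hH.2]
  have hr1 : 2 * (1 - H) < 1 := by linarith [hH.1]
  obtain ⟨c, hγc⟩ : ∃ c, ∀ k, |LongMemoryRegression.autoCov u P k| ≤ c := by
    obtain ⟨M, hM, hbd⟩ := LongMemoryRegression.exists_bound_of_tendsto_mul_rpow hγ
    refine ⟨M, fun k => (hbd k).trans ?_⟩
    exact mul_le_of_le_one_right hM (Real.rpow_le_one_of_one_le_of_nonpos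
      (by linarith [Nat.cast_nonneg (α := ℝ) k]) (by linarith))
  have hexp : -(2 - 2 * (1 - H)) = -(2 * H) := by ring
  have hvar := LongMemoryRegression.tendsto_sum_sum_natAbs_sub hr0 hr1 hγ
  have hvar_abs := LongMemoryRegression.tendsto_sum_sum_natAbs_sub
    (g := fun k => |LongMemoryRegression.autoCov u P k|) (K := |K|) hr0 hr1
    (hγ.abs.congr fun k => by
      rw [abs_mul, abs_of_nonneg (Real.rpow_nonneg (Nat.cast_nonneg k) _)])
  rw [hexp] at hvar hvar_abs
  have hM := hvar_abs.eventually (ge_mem_nhds (lt_add_one _))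
  -- the limit of the partial sums of the errors
  have hψ : 2 * (K / ((1 - 2 * (1 - H)) * (2 - 2 * (1 - H))))
      = K / LongMemoryRegression.theta H * LongMemoryRegression.dConst H := by
    have h1 : 2 * H - 1 ≠ 0 := by linarith [hH.1]
    have h2 : H ≠ 0 := by linarith [hH.1]
    rw [LongMemoryRegression.dConst, show 1 - 2 * (1 - H) = 2 * H - 1 by ring,
      show 2 - 2 * (1 - H) = 2 * H by ring]
    field_simp
  have hψ0 : 0 ≤ K / LongMemoryRegression.theta H * LongMemoryRegression.dConst H := by
    have h1 : 0 < 2 * H - 1 := by linarith [hH.1]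
    have h2 : 0 < H := by linarith [hH.1]
    unfold LongMemoryRegression.dConst
    positivity
  rw [hψ] at hvar
  have hU := hu.tendstoInDistribution_sum hε hb_sq hH.1 hψ0 hvar
  -- the weighted sums of errors and the empirical moments of the design
  have hR₀ := LongMemoryRegression.tendstoInMeasure_sum_centered_mul hX_meas hX_gauss hX_stat hv
    hCovX huL hind huγ hγc hH.1 hM (τ := σ) (w := fun x => |σ x|) hσ_meas
    (fun x => le_mul_of_one_le_left (abs_nonneg _) (by linarith [abs_nonneg x]))
    (by fun_prop) hσ.norm
  have hR₁ := LongMemoryRegression.tendstoInMeasure_sum_centered_mul hX_meas hX_gauss hX_stat hv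
    hCovX huL hind huγ hγc hH.1 hM (τ := fun x => x * σ x) (w := fun x => |σ x|) (by fun_prop)
    (fun x => by rw [abs_mul]; gcongr; linarith) (by fun_prop) hσ.norm
  have hm := LongMemoryRegression.tendstoInMeasure_mean hX_meas hX_gauss hX_stat hv hCovX
    (τ := fun x => x) (w := fun _ => 1) (by fun_prop) (fun x => by linarith) (by fun_prop)
    (memLp_const 1)
  have hs := LongMemoryRegression.tendstoInMeasure_mean hX_meas hX_gauss hX_stat hv hCovX
    (τ := fun x => x ^ 2) (w := fun x => |x|) (by fun_prop)
    (fun x => by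
      rw [abs_of_nonneg (sq_nonneg x), ← sq_abs]
      nlinarith [abs_nonneg x]) (by fun_prop) (hXL 0).norm
  have hum : ∀ t, AEMeasurable (u t) P := fun t => (huL t).1.aemeasurable
  have hvq : Var[X 0; P] = (∫ ω, X 0 ω ^ 2 ∂P) - (∫ ω, X 0 ω ∂P) ^ 2 := variance_eq_sub (hXL 0)
  have hD := LongMemoryRegression.tendstoInDistribution_of_normal_equations hv hvq hU
    hR₀ (fun n => .const_mul (Finset.aemeasurable_fun_sum _ fun t _ =>
      ((hσ_meas.comp (hX_meas t)).aemeasurable.sub_const _).mul (hum t)) _)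
    hR₁ (fun n => .const_mul (Finset.aemeasurable_fun_sum _ fun t _ =>
      (((hX_meas t).mul (hσ_meas.comp (hX_meas t))).aemeasurable.sub_const _).mul (hum t)) _)
    hm (fun n => .const_mul (Finset.aemeasurable_fun_sum _ fun t _ =>
      (hX_meas t).aemeasurable.sub_const _) _)
    hs (fun n => .const_mul (Finset.aemeasurable_fun_sum _ fun t _ =>
      ((hX_meas t).pow_const 2).aemeasurable.sub_const _) _)
    (D₀ := fun (n : ℕ) ω => (n : ℝ) ^ (1 - H) * (βhat₀ n ω - β₀))
    (D₁ := fun (n : ℕ) ω => (n : ℝ) ^ (1 - H) * (βhat₁ n ω - β₁))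
    (a := ∫ ω, σ (X 0 ω) ∂P) (J := ∫ ω, X 0 ω * σ (X 0 ω) ∂P)
    (fun n => ((hβhat₀ n).sub_const _).const_mul _)
    (fun n => ((hβhat₁ n).sub_const _).const_mul _) (by
      filter_upwards [eventually_gt_atTop 0] with n hn
      filter_upwards [hβhat n, ae_all_iff.2 hY] with ω hω hYω
      exact LongMemoryRegression.normal_equations_rescaled hn hYω hω _ _ _ _)
  refine ⟨⟨K / LongMemoryRegression.theta H, div_pos hK hθ, ?_, hU, hD⟩, fun hdeg => ?_⟩
  · rw [div_mul_cancel₀ _ hθ.ne']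
    exact (LongMemoryRegression.isEquivalent_const_mul_rpow_iff hK.ne').2 hγ
  · have hΓ := LongMemoryRegression.Gamma1_eq_zero (hX_gauss.hasGaussianLaw_eval 0) hσ_meas hdeg
    refine ⟨hΓ, ?_⟩
    have h2 : TendstoInDistribution
        (fun (n : ℕ) ω => (n : ℝ) ^ (1 - H) * (βhat₁ n ω - β₁)) atTop (fun _ : ℝ => (0 : ℝ))
        (fun _ => P) (gaussianReal 0
          (K / LongMemoryRegression.theta H * LongMemoryRegression.dConst H).toNNReal) := by
      refine (hD.continuous_comp continuous_snd).congr (fun _ => EventuallyEq.rfl)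
        (Eventually.of_forall fun z => ?_)
      change LongMemoryRegression.Gamma1 (X 0) σ P * z = 0
      rw [hΓ, zero_mul]
    -- both limit laws are the Dirac mass at zero
    refine ⟨h2.forall_aemeasurable, aemeasurable_const, ?_⟩
    convert! h2.tendsto using 2
    refine congrArg 𝓝 (Subtype.ext ?_)
    simp only [Measure.map_const, measure_univ]
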